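/- **Setting.** Let $V$ be a set of $n$ elements of a totally ordered set. Comparing two distinct elements $u,w\in V$ reveals their order at a cost $c_{\{u,w\}}\in[0,1]$; the costs are known to the algorithm, the order is not. Given a set $P$ of performed comparisons, $P$ *certifies* $u<w$ if there is a directed path $u=x_0<x_1<\dots<x_m=w$ ($m\ge1$) with all $\{x_{j},x_{j+1}\}\in P$; $u,w$ are then *comparable*. The cost of $P$ is $\sum_{e\in P}c_e$. $P$ is a *rank certificate* for $x$ if every $u\neq x$ is comparable with $x$, and a *sorting certificate* if it contains the comparisons of all pairs of consecutive elements in the sorted order. **UniformFindRankCertificate**$[V,v]$, where $v\in V$: put $n=|V|$, $\alpha=1200\log^2 n$, $R=V$, $V_1=V_2=\emptyset$. Perform all comparisons within $R$ with cost in $[0,\alpha/n]$; then remove from $R$ every $u$ that the comparisons performed so far in this call make comparable with $v$, putting it in $V_1$ if $u<v$ and in $V_2$ if $u>v$. For $i=1,\dots,\lceil\log_2(n/\alpha)\rceil$ (no rounds if $n\le\alpha$ or $n=1$), do the same with the cost range $[\alpha2^{i-1}/n,\alpha2^i/n]$. Return $V_1,V_2$. **UniformSelection**$[V,k]$, where $1\le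 k\le|V|$: pick a uniformly random pivot $v\in V$, independently of everything else, and let $(V_1,V_2)$ be the result of UniformFindRankCertificate$[V,v]$. If $k\le|V_1|$, return UniformSelection$[V_1,k]$; if $k=|V_1|+1$, return $v$; otherwise return UniformSelection$[V_2,k-|V_1|-1]$. **UniformSort**$[V]$: if $V=\emptyset$, return the empty list; otherwise pick a uniformly random pivot $v\in V$, independently of everything else, let $(V_1,V_2)$ be the result of UniformFindRankCertificate$[V,v]$, and return the list (UniformSort$[V_1]$, $v$, UniformSort$[V_2]$). The certificate revealed by a run is the set of all comparisons performed in it. **Theorem.** 1. For all costs in $[0,1]$ and all choices of the pivots, UniformSelection$[V,k]$ with $1\le k\le n$ returns the $k$-th smallest element of $V$, and the comparisons performed form a rank certificate for it; UniformSort$[V]$ returns the list of the elements of $V$ in increasing order, and the comparisons performed form a sorting certificate. 2. There is an absolute constant $C$ such that, whenever the costs $c_{\{u,w\}}$ ($u\ne w$ in $V$) are independent and uniform on $[0,1]$, the expected cost (over the costs and the pivots) of the certificate revealed by UniformSelection$[V,k]$ is at most $C\log^6 n$ for every $1\le k\le n$, and the expected cost of the certificate revealed by UniformSort$[V]$ is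 at most $Cn$. -/

import Mathlib

open MeasureTheory ProbabilityTheory

namespace UniformCosts

variable {E : Type*} [LinearOrder E]

/-- `CertLT P a b`: the performed comparisons `P` certify `a < b`, that is, there is a directed
path from `a` to `b` all of whose edges are in `P`, where the edge `{x, y}` of `P` reveals the
true order of `x` and `y`.  The algorithms below access the order of `E` only through `CertLT`. -/
def CertLT (P : Finset (Sym2 E)) (a b : E) : Prop :=
  Relation.TransGen (fun x y => s(x, y) ∈ P ∧ x < y) a b

noncomputable instance (P : Finset (Sym2 E)) (a b : E) : Decidable (CertLT P a b) :=
  Classical.dec _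

/-- The cost of a set of comparisons. -/
def certCost (c : Sym2 E → ℝ) (P : Finset (Sym2 E)) : ℝ := ∑ e ∈ P, c e

/-- The comparisons between two distinct elements of `V` with cost in `[lo, hi]`. -/
noncomputable def comparisonsIn (c : Sym2 E → ℝ) (V : Finset E) (lo hi : ℝ) : Finset (Sym2 E) :=
  V.sym2.filter (fun e => ¬ e.IsDiag ∧ lo ≤ c e ∧ c e ≤ hi)

/-- The parameter `α = 1200 log² n`. -/
noncomputable def alpha (n : ℕ) : ℝ := 1200 * Real.log n ^ 2

/-- State of the pivot routine: the elements not yet known to be comparable with the pivot (the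
pivot itself stays among them), the elements certified to be smaller and to be larger than the
pivot, and the comparisons performed so far. -/
structure PivotState (E : Type*) where
  rem : Finset E
  lower : Finset E
  upper : Finset E
  probed : Finset (Sym2 E)

/-- One round of the pivot routine: perform all comparisons with cost in `[lo, hi]` among the
remaining elements, then move each remaining element that has become comparable with `v`
to `lower` or to `upper`. -/
noncomputable def pivotRound (c : Sym2 E → ℝ) (v : E) (s : PivotState E) (lo hi : ℝ) :
    PivotState E where
  rem := {u ∈ s.rem | ¬ CertLT (s.probed ∪ comparisonsIn c s.rem lo hi) u v ∧
    ¬ CertLT (s.probed ∪ comparisonsIn c s.rem lo hi) v u}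
  lower := s.lower ∪ {u ∈ s.rem | CertLT (s.probed ∪ comparisonsIn c s.rem lo hi) u v}
  upper := s.upper ∪ {u ∈ s.rem | CertLT (s.probed ∪ comparisonsIn c s.rem lo hi) v u}
  probed := s.probed ∪ comparisonsIn c s.rem lo hi

/-- The state after the initial round with cost range `[0, α/n]` and the rounds `1, …, i`, where
round `j` has cost range `[α 2^(j-1)/n, α 2^j/n]`; here `n = |V|`. -/
noncomputable def pivotState (c : Sym2 E → ℝ) (V : Finset E) (v : E) : ℕ → PivotState E
  | 0 => pivotRound c v ⟨V, ∅, ∅, ∅⟩ 0 (alpha V.card / V.card)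
  | i + 1 => pivotRound c v (pivotState c V v i)
      (alpha V.card * 2 ^ i / V.card) (alpha V.card * 2 ^ (i + 1) / V.card)

/-- `UniformFindRankCertificate[V, v]`: the initial round followed by `⌈log₂ (n/α)⌉` rounds
(none if `n ≤ α`). -/
noncomputable def findRankCertificate (c : Sym2 E → ℝ) (V : Finset E) (v : E) : PivotState E :=
  pivotState c V v ⌈Real.logb 2 (V.card / alpha V.card)⌉₊

theorem CertLT.lt {P : Finset (Sym2 E)} {a b : E} (h : CertLT P a b) : a < b := by
  induction h with
  | single h => exact h.2
  | tail _ h ih => exact ih.trans h.2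

theorem pivotState_subset (c : Sym2 E → ℝ) (V : Finset E) (v : E) (i : ℕ) :
    (pivotState c V v i).rem ⊆ V ∧ (pivotState c V v i).lower ⊆ V.erase v ∧
      (pivotState c V v i).upper ⊆ V.erase v := by
  have key : ∀ (s : PivotState E) (lo hi : ℝ),
      (s.rem ⊆ V ∧ s.lower ⊆ V.erase v ∧ s.upper ⊆ V.erase v) →
      ((pivotRound c v s lo hi).rem ⊆ V ∧ (pivotRound c v s lo hi).lower ⊆ V.erase v ∧
        (pivotRound c v s lo hi).upper ⊆ V.erase v) := by
    rintro s lo hi ⟨h1, h2, h3⟩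
    refine ⟨(Finset.filter_subset _ _).trans h1, Finset.union_subset h2 ?_,
      Finset.union_subset h3 ?_⟩
    · intro u hu
      rw [Finset.mem_filter] at hu
      exact Finset.mem_erase.2 ⟨hu.2.lt.ne, h1 hu.1⟩
    · intro u hu
      rw [Finset.mem_filter] at hu
      exact Finset.mem_erase.2 ⟨hu.2.lt.ne', h1 hu.1⟩
  induction i with
  | zero => exact key _ _ _ ⟨subset_rfl, by simp, by simp⟩
  | succ i ih => exact key _ _ _ ih

theorem card_lower_lt (c : Sym2 E → ℝ) (V : Finset E) (v : V) :
    (findRankCertificate c V v).lower.card < V.card :=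
  (Finset.card_le_card (pivotState_subset c V v _).2.1).trans_lt
    (Finset.card_erase_lt_of_mem v.2)

theorem card_upper_lt (c : Sym2 E → ℝ) (V : Finset E) (v : V) :
    (findRankCertificate c V v).upper.card < V.card :=
  (Finset.card_le_card (pivotState_subset c V v _).2.2).trans_lt
    (Finset.card_erase_lt_of_mem v.2)

/-- `UniformSelection[V, k]`, with fresh uniformly random pivots, as the distribution of the pair
(returned element, set of all comparisons performed); `k` counts from `1`.  If `|V| = 1`, the pivot
is the only element and no comparison is performed.  The value `none` is a placeholder for the
meaningless call on the empty set. -/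
noncomputable def uniformSelection (c : Sym2 E → ℝ) (V : Finset E) (k : ℕ) :
    PMF (Option E × Finset (Sym2 E)) :=
  if h : V.Nonempty then
    haveI : Nonempty V := h.to_subtype
    (PMF.uniformOfFintype V).bind fun v =>
      if k ≤ (findRankCertificate c V v).lower.card then
        (uniformSelection c (findRankCertificate c V v).lower k).map fun r =>
          (r.1, (findRankCertificate c V v).probed ∪ r.2)
      else if k = (findRankCertificate c V v).lower.card + 1 then
        PMF.pure (some (v : E), (findRankCertificate c V v).probed)
      else
        (uniformSelection c (findRankCertificate c V v).upper
            (k - (findRankCertificate c V v).lower.card - 1)).map fun r =>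
          (r.1, (findRankCertificate c V v).probed ∪ r.2)
  else PMF.pure (none, ∅)
termination_by V.card
decreasing_by
  · exact card_lower_lt c V v
  · exact card_upper_lt c V v

/-- `UniformSort[V]`, with fresh uniformly random pivots, as the distribution of the pair
(returned list, set of all comparisons performed). -/
noncomputable def uniformSort (c : Sym2 E → ℝ) (V : Finset E) :
    PMF (List E × Finset (Sym2 E)) :=
  if h : V.Nonempty then
    haveI : Nonempty V := h.to_subtype
    (PMF.uniformOfFintype V).bind fun v =>
      (uniformSort c (findRankCertificate c V v).lower).bind fun r₁ =>
        (uniformSort c (findRankCertificate c V v).upper).map fun r₂ =>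
          (r₁.1 ++ (v : E) :: r₂.1, (findRankCertificate c V v).probed ∪ r₁.2 ∪ r₂.2)
  else PMF.pure ([], ∅)
termination_by V.card
decreasing_by
  · exact card_lower_lt c V v
  · exact card_upper_lt c V v

/-- `P` certifies the rank of `x`: it contains a directed path between `x` and each of the
other elements. -/
def IsRankCertificate (P : Finset (Sym2 E)) (x : E) : Prop :=
  ∀ u, u ≠ x → CertLT P u x ∨ CertLT P x u

/-- `P` certifies that the list `L` is in increasing order: consecutive entries of `L` are in
increasing order and their comparison belongs to `P`. -/
def IsSortingCertificate (P : Finset (Sym2 E)) (L : List E) : Prop :=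
  L.IsChain (fun a b => s(a, b) ∈ P ∧ a < b)

/-- The expectation, over the random pivots, of the cost of the set of comparisons performed by a
randomized algorithm, for the given cost function. -/
noncomputable def expectedCost [Fintype E] {α : Type*} (c : Sym2 E → ℝ)
    (p : PMF (α × Finset (Sym2 E))) : ℝ :=
  ∑ P : Finset (Sym2 E), ((p.map Prod.snd) P).toReal * certCost c P

/-- The comparison costs are independent and uniform on `[0, 1]`. -/
structure IIDUniformCosts {Ω : Type*} [MeasurableSpace Ω] (μ : Measure Ω)
    (c : Ω → Sym2 E → ℝ) : Prop where
  indep : iIndepFun (fun (e : {e : Sym2 E // ¬ e.IsDiag}) (ω : Ω) => c ω e) μ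
  law : ∀ e : Sym2 E, ¬ e.IsDiag →
    HasLaw (fun ω => c ω e) (volume.restrict (Set.Icc (0 : ℝ) 1)) μ

end UniformCosts

/-! Correctness. The cost ranges of the pivot routine tile an interval containing `[0, 1]`, so an
element still remaining in the last round is compared directly with the pivot `v`. Hence the two
returned parts are exactly the elements below and above `v` (`UnitCosts.lower_eq`,
`UnitCosts.upper_eq`), and certificates for the parts are glued by concatenating paths at `v`.

Cost of one pivot call. Call an edge cheap if its cost is at most `q`, and scan the elements above
`v` in increasing order, keeping the set of those reached from `v` by cheap directed paths. When `k`
elements are reached, the next one is missed with probability `(1 - q) ^ k`, decided by edges not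
examined before. The mean number of misses before the next hit is therefore at most `1 / (q k)`. In
total the number of misses has mean at most `(1 + log n) / q` and second moment of the order of the
square of that (`integral_unreached_le`); the elements below `v` are symmetric.

Later rounds act on a random set of remaining elements, so fresh randomness is needed. The state
after the round with threshold `p` depends only on costs up to `p`. Replacing every cost above `p`
by `p + (1 - p) y` with `y` fresh and uniform preserves the law and, almost surely, that state.
Since `y ≤ p` makes the new cost at most `2 p`, the next threshold, the next round contains a fresh
random graph of edge probability `p` on the remaining set. This bounds the second moment of the
number of remaining elements (`lintegral_card_rem_sq_le`). A round then costs `O(log² n)`, the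
`O(log n)` rounds together `O(log³ n)`, and the initial round `O(α²) = O(log⁴ n)`.

Recursion. Almost surely the parts are determined by the pivot alone, so a recursive call runs on a
set independent of the costs, under the original cost law. Dependence between calls is thus harmless
and linearity of expectation suffices. For selection, the logarithm of the size drops by at least
`1/6` on average, which gives `O(log⁵ n)`. For sorting, the cost `O(log⁴ n) = O(√n)` of a call is
absorbed by a supersolution `K (n + 1 - √(n + 1))` of the quicksort recursion. -/

namespace UniformCosts

/-! ### Certified paths and cost thresholds -/

section

variable {E : Type*} [LinearOrder E]

theorem CertLT.mono {P Q : Finset (Sym2 E)} (h : P ⊆ Q) {a b : E} (hab : CertLT P a b) :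
    CertLT Q a b :=
  Relation.TransGen.mono (p := fun x y => s(x, y) ∈ Q ∧ x < y)
    (fun _ _ hxy => ⟨h hxy.1, hxy.2⟩) a b hab

theorem CertLT.trans {P : Finset (Sym2 E)} {a b c : E} (hab : CertLT P a b)
    (hbc : CertLT P b c) : CertLT P a c :=
  Relation.TransGen.trans hab hbc

theorem CertLT.of_mem {P : Finset (Sym2 E)} {a b : E} (hab : a < b) (h : s(a, b) ∈ P) :
    CertLT P a b :=
  Relation.TransGen.single ⟨h, hab⟩

/-- A certified relation between two elements with nothing in between is a performed
comparison. -/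
theorem CertLT.mem_of_covBy {P : Finset (Sym2 E)} {a b : E} (h : CertLT P a b) (hab : a ⋖ b) :
    s(a, b) ∈ P := by
  obtain ⟨x, h, hx⟩ := Relation.TransGen.head'_iff.1 h
  rcases Relation.reflTransGen_iff_eq_or_transGen.1 hx with rfl | hx
  · exact h.1
  · exact absurd (CertLT.lt hx) (hab.2 h.2)

/-- The upper end of the cost range of round `i` of the pivot routine on `n` elements. -/
noncomputable def threshold (n i : ℕ) : ℝ := alpha n * 2 ^ i / n

/-- The number of rounds of the pivot routine on `n` elements after the initial one. -/
noncomputable def roundCount (n : ℕ) : ℕ := ⌈Real.logb 2 (n / alpha n)⌉₊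

theorem alpha_nonneg (n : ℕ) : 0 ≤ alpha n := by unfold alpha; positivity

theorem threshold_nonneg (n i : ℕ) : 0 ≤ threshold n i := by
  have := alpha_nonneg n
  unfold threshold; positivity

theorem threshold_zero (n : ℕ) : threshold n 0 = alpha n / n := by simp [threshold]

theorem threshold_succ (n i : ℕ) : threshold n (i + 1) = 2 * threshold n i := by
  unfold threshold; ring

theorem threshold_mono (n : ℕ) : Monotone (threshold n) :=
  monotone_nat_of_le_succ fun i => by
    rw [threshold_succ]; linarith [threshold_nonneg n i]

theorem one_lt_alpha {n : ℕ} (hn : 2 ≤ n) : 1 < alpha n := by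
  have h1 : Real.log 2 ≤ Real.log n := Real.log_le_log (by norm_num) (by exact_mod_cast hn)
  have h2 := Real.log_two_gt_d9
  unfold alpha
  nlinarith

/-- The ceiling in the number of rounds pushes the last range up to cost `1`, so the last round
makes every comparison still outstanding. -/
theorem one_le_threshold_roundCount {n : ℕ} (hn : 2 ≤ n) : 1 ≤ threshold n (roundCount n) := by
  have hα := one_lt_alpha hn
  have hn' : (0 : ℝ) < n := by positivity
  have h1 : Real.logb 2 (n / alpha n) ≤ (roundCount n : ℕ) := Nat.le_ceil _
  rw [Real.logb_le_iff_le_rpow (by norm_num) (by positivity), Real.rpow_natCast,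
    div_le_iff₀ (by positivity)] at h1
  unfold threshold
  rw [le_div_iff₀ hn']
  linarith

theorem threshold_lt_one {n i : ℕ} (hn : 2 ≤ n) (hi : i < roundCount n) : threshold n i < 1 := by
  have hα := one_lt_alpha hn
  have hn' : (0 : ℝ) < n := by positivity
  have h1 : (i : ℝ) < Real.logb 2 (n / alpha n) := Nat.lt_ceil.1 hi
  rw [Real.lt_logb_iff_rpow_lt (by norm_num) (by positivity), Real.rpow_natCast,
    lt_div_iff₀ (by positivity)] at h1
  unfold threshold
  rw [div_lt_one hn']
  linarith

/-! ### Invariants of the pivot routine -/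

section PivotState

variable (c : Sym2 E → ℝ) (V : Finset E) (v : E)

theorem mem_comparisonsIn {c : Sym2 E → ℝ} {V : Finset E} {lo hi : ℝ} {e : Sym2 E} :
    e ∈ comparisonsIn c V lo hi ↔ e ∈ V.sym2 ∧ ¬ e.IsDiag ∧ lo ≤ c e ∧ c e ≤ hi := by
  simp [comparisonsIn]

theorem pivotState_zero :
    pivotState c V v 0 = pivotRound c v ⟨V, ∅, ∅, ∅⟩ 0 (threshold V.card 0) := by
  rw [threshold_zero, pivotState]

theorem pivotState_succ (i : ℕ) : pivotState c V v (i + 1) =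
    pivotRound c v (pivotState c V v i) (threshold V.card i) (threshold V.card (i + 1)) := rfl

theorem rem_pivotState_succ_subset (i : ℕ) :
    (pivotState c V v (i + 1)).rem ⊆ (pivotState c V v i).rem :=
  Finset.filter_subset _ _

theorem not_certLT_of_mem_rem {i : ℕ} {u : E} (hu : u ∈ (pivotState c V v i).rem) :
    ¬ CertLT (pivotState c V v i).probed u v ∧ ¬ CertLT (pivotState c V v i).probed v u := by
  cases i <;> exact (Finset.mem_filter.1 hu).2

theorem mem_rem_or_lower_or_upper {u : E} (hu : u ∈ V) (i : ℕ) :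
    u ∈ (pivotState c V v i).rem ∨ u ∈ (pivotState c V v i).lower ∨
      u ∈ (pivotState c V v i).upper := by
  have key : ∀ (s : PivotState E) (lo hi : ℝ), (u ∈ s.rem ∨ u ∈ s.lower ∨ u ∈ s.upper) →
      (u ∈ (pivotRound c v s lo hi).rem ∨ u ∈ (pivotRound c v s lo hi).lower ∨
      u ∈ (pivotRound c v s lo hi).upper) := by
    intro s lo hi h
    simp only [pivotRound, Finset.mem_filter, Finset.mem_union]
    tauto
  induction i with
  | zero => exact key _ _ _ (Or.inl hu)
  | succ i ih => exact key _ _ _ ih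

theorem certLT_of_mem_lower_upper (i : ℕ) :
    (∀ u ∈ (pivotState c V v i).lower, CertLT (pivotState c V v i).probed u v) ∧
    (∀ u ∈ (pivotState c V v i).upper, CertLT (pivotState c V v i).probed v u) := by
  have key : ∀ (s : PivotState E) (lo hi : ℝ),
      ((∀ u ∈ s.lower, CertLT s.probed u v) ∧ (∀ u ∈ s.upper, CertLT s.probed v u)) →
      ((∀ u ∈ (pivotRound c v s lo hi).lower, CertLT (pivotRound c v s lo hi).probed u v) ∧
       (∀ u ∈ (pivotRound c v s lo hi).upper, CertLT (pivotRound c v s lo hi).probed v u)) := by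
    rintro s lo hi ⟨h1, h2⟩
    constructor <;> intro u hu <;> rcases Finset.mem_union.1 hu with hu | hu
    · exact (h1 u hu).mono Finset.subset_union_left
    · exact (Finset.mem_filter.1 hu).2
    · exact (h2 u hu).mono Finset.subset_union_left
    · exact (Finset.mem_filter.1 hu).2
  induction i with
  | zero => exact key _ _ _ (by simp)
  | succ i ih => exact key _ _ _ ih

theorem pivot_mem_rem {v : E} (hv : v ∈ V) (i : ℕ) : v ∈ (pivotState c V v i).rem := by
  have key : ∀ (s : PivotState E) (lo hi : ℝ), v ∈ s.rem → v ∈ (pivotRound c v s lo hi).rem :=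
    fun s lo hi h => Finset.mem_filter.2 ⟨h, fun h => h.lt.ne rfl, fun h => h.lt.ne rfl⟩
  induction i with
  | zero => exact key _ _ _ hv
  | succ i ih => exact key _ _ _ ih

theorem not_isDiag_and_mem_of_mem_probed {i : ℕ} {e : Sym2 E}
    (he : e ∈ (pivotState c V v i).probed) : ¬ e.IsDiag ∧ e ∈ V.sym2 := by
  have key : ∀ (s : PivotState E) (lo hi : ℝ), s.rem ⊆ V →
      (∀ e ∈ s.probed, ¬ e.IsDiag ∧ e ∈ V.sym2) →
      ∀ e ∈ (pivotRound c v s lo hi).probed, ¬ e.IsDiag ∧ e ∈ V.sym2 := by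
    intro s lo hi hs h e he
    rcases Finset.mem_union.1 he with he | he
    · exact h e he
    · rw [mem_comparisonsIn] at he
      exact ⟨he.2.1, Finset.sym2_mono hs he.1⟩
  induction i generalizing e with
  | zero => exact key _ _ _ subset_rfl (by simp) e he
  | succ i ih => exact key _ _ _ (pivotState_subset c V v i).1 (fun e he => ih he) e he

/-- The remaining elements among which the comparisons of round `i` are made. -/
noncomputable def remBefore : ℕ → Finset E
  | 0 => V
  | i + 1 => (pivotState c V v i).rem

theorem remBefore_succ_subset (i : ℕ) : remBefore c V v (i + 1) ⊆ remBefore c V v i := by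
  cases i with
  | zero => exact (pivotState_subset c V v 0).1
  | succ i => exact rem_pivotState_succ_subset c V v i

/-- The ranges tile `[0, threshold]` and the remaining sets shrink, so the pair was already
available in the earlier round whose range contains its cost. -/
theorem mem_probed_of_le {i : ℕ} {e : Sym2 E} (he : e ∈ (remBefore c V v i).sym2)
    (hd : ¬ e.IsDiag) (h0 : 0 ≤ c e) (h1 : c e ≤ threshold V.card i) :
    e ∈ (pivotState c V v i).probed := by
  induction i with
  | zero =>
    rw [pivotState_zero]
    exact Finset.mem_union_right _ (mem_comparisonsIn.2 ⟨he, hd, h0, h1⟩)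
  | succ i ih =>
    rw [pivotState_succ]
    by_cases h : c e ≤ threshold V.card i
    · exact Finset.mem_union_left _ (ih (Finset.sym2_mono (remBefore_succ_subset c V v i) he) h)
    · exact Finset.mem_union_right _ (mem_comparisonsIn.2 ⟨he, hd, (not_le.1 h).le, h1⟩)

theorem rem_pivotState_subset_remBefore (i : ℕ) : (pivotState c V v i).rem ⊆ remBefore c V v i :=
  remBefore_succ_subset c V v i

end PivotState

/-! ### Correctness of the pivot routine, selection and sorting -/

/-- All costs of comparisons of distinct elements lie in `[0, 1]`. -/
def UnitCosts (c : Sym2 E → ℝ) : Prop := ∀ e : Sym2 E, ¬ e.IsDiag → c e ∈ Set.Icc (0 : ℝ) 1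

theorem UnitCosts.eq_of_mem_rem {c : Sym2 E → ℝ} (hc : UnitCosts c) {V : Finset E} {v : E}
    (hv : v ∈ V) {u : E} (hu : u ∈ (findRankCertificate c V v).rem) : u = v := by
  by_contra huv
  have huV : u ∈ V := (pivotState_subset c V v _).1 hu
  -- For a single element `alpha` vanishes and the thresholds never reach `1`, so this case has to
  -- be excluded.
  have hcard : 2 ≤ V.card := Finset.one_lt_card.2 ⟨u, huV, v, hv, huv⟩
  have hd : ¬ s(u, v).IsDiag := by simpa using huv
  have hmem : s(u, v) ∈ (remBefore c V v (roundCount V.card)).sym2 := by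
    rw [Finset.mk_mem_sym2_iff]
    exact ⟨rem_pivotState_subset_remBefore c V v _ hu,
      rem_pivotState_subset_remBefore c V v _ (pivot_mem_rem c V hv _)⟩
  have hp := mem_probed_of_le c V v hmem hd (hc _ hd).1
    ((hc _ hd).2.trans (one_le_threshold_roundCount hcard))
  have hn := not_certLT_of_mem_rem c V v hu
  rcases lt_or_gt_of_ne huv with h | h
  · exact hn.1 (CertLT.of_mem h hp)
  · exact hn.2 (CertLT.of_mem h (Sym2.eq_swap ▸ hp))

theorem UnitCosts.lower_eq {c : Sym2 E → ℝ} (hc : UnitCosts c) {V : Finset E} {v : E}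
    (hv : v ∈ V) : (findRankCertificate c V v).lower = {u ∈ V | u < v} := by
  have hcert := certLT_of_mem_lower_upper c V v (roundCount V.card)
  ext u
  simp only [Finset.mem_filter]
  constructor
  · intro hu
    exact ⟨Finset.mem_of_mem_erase ((pivotState_subset c V v _).2.1 hu), (hcert.1 u hu).lt⟩
  · rintro ⟨hu, huv⟩
    rcases mem_rem_or_lower_or_upper c V v hu (roundCount V.card) with h | h | h
    · exact absurd (hc.eq_of_mem_rem hv h) huv.ne
    · exact h
    · exact absurd (hcert.2 u h).lt huv.not_gt

theorem UnitCosts.upper_eq {c : Sym2 E → ℝ} (hc : UnitCosts c) {V : Finset E} {v : E}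
    (hv : v ∈ V) : (findRankCertificate c V v).upper = {u ∈ V | v < u} := by
  have hcert := certLT_of_mem_lower_upper c V v (roundCount V.card)
  ext u
  simp only [Finset.mem_filter]
  constructor
  · intro hu
    exact ⟨Finset.mem_of_mem_erase ((pivotState_subset c V v _).2.2 hu), (hcert.2 u hu).lt⟩
  · rintro ⟨hu, huv⟩
    rcases mem_rem_or_lower_or_upper c V v hu (roundCount V.card) with h | h | h
    · exact absurd (hc.eq_of_mem_rem hv h) huv.ne'
    · exact absurd (hcert.1 u h).lt huv.not_gt
    · exact h

theorem UnitCosts.certLT_pivot {c : Sym2 E → ℝ} (hc : UnitCosts c) {V : Finset E} {v u : E}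
    (hv : v ∈ V) (hu : u ∈ V) :
    (u < v → CertLT (findRankCertificate c V v).probed u v) ∧
    (v < u → CertLT (findRankCertificate c V v).probed v u) := by
  have hcert := certLT_of_mem_lower_upper c V v (roundCount V.card)
  refine ⟨fun h => hcert.1 u ?_, fun h => hcert.2 u ?_⟩
  · exact (hc.lower_eq hv).symm ▸ Finset.mem_filter.2 ⟨hu, h⟩
  · exact (hc.upper_eq hv).symm ▸ Finset.mem_filter.2 ⟨hu, h⟩

theorem card_filter_lt_add_card_filter_gt {V : Finset E} {v : E} (hv : v ∈ V) :
    (V.filter (· < v)).card + 1 + (V.filter (v < ·)).card = V.card := by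
  have h1 := Finset.card_filter_add_card_filter_not (s := V) (fun u => u < v)
  have h2 : V.filter (fun u => ¬ u < v) = insert v (V.filter (v < ·)) := by
    ext u
    simp only [Finset.mem_filter, Finset.mem_insert, not_lt]
    constructor
    · rintro ⟨h, h'⟩
      rcases h'.eq_or_lt with rfl | h''
      · exact Or.inl rfl
      · exact Or.inr ⟨h, h''⟩
    · rintro (rfl | h)
      · exact ⟨hv, le_rfl⟩
      · exact ⟨h.1, h.2.le⟩
  rw [h2, Finset.card_insert_of_notMem (by simp)] at h1
  omega

/-- Certificates inside a part extend to `V` through the pivot: an element on the other side of `v`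
from `x` is joined to `x` by two paths meeting at `v`. -/
theorem UnitCosts.uniformSelection_correct {c : Sym2 E → ℝ} (hc : UnitCosts c) (V : Finset E)
    (k : ℕ) (hk : 1 ≤ k) (hkV : k ≤ V.card) :
    ∀ r ∈ (uniformSelection c V k).support, ∃ x ∈ V, r.1 = some x ∧
      (V.filter (· ≤ x)).card = k ∧
      ∀ u ∈ V, (u < x → CertLT r.2 u x) ∧ (x < u → CertLT r.2 x u) := by
  induction hn : V.card using Nat.strong_induction_on generalizing V k with
  | _ n ih =>
    subst hn
    have hV : V.Nonempty := Finset.card_pos.1 (by omega)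
    intro r hr
    rw [uniformSelection, dif_pos hV] at hr
    obtain ⟨⟨v, hv⟩, -, hr⟩ := (PMF.mem_support_bind_iff _ _ _).1 hr
    have hcard := card_filter_lt_add_card_filter_gt hv
    have hlow := hc.lower_eq hv
    have hupp := hc.upper_eq hv
    simp only at hr
    split_ifs at hr with h1 h2
    · obtain ⟨r', hr', rfl⟩ := (PMF.mem_support_map_iff _ _ _).1 hr
      obtain ⟨x, hx, hrx, hcx, hcert⟩ := ih _ (card_lower_lt c V ⟨v, hv⟩) _ k hk h1 rfl r' hr'
      rw [hlow] at hx hcx hcert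
      obtain ⟨hxV, hxv⟩ := Finset.mem_filter.1 hx
      refine ⟨x, hxV, hrx, ?_, fun u hu => ⟨fun h => ?_, fun h => ?_⟩⟩
      · rw [← hcx, Finset.filter_filter]
        congr 1
        ext u
        simp only [Finset.mem_filter]
        exact ⟨fun h => ⟨h.1, h.2.trans_lt hxv, h.2⟩, fun h => ⟨h.1, h.2.2⟩⟩
      · exact ((hcert u (Finset.mem_filter.2 ⟨hu, h.trans hxv⟩)).1 h).mono
          Finset.subset_union_right
      · have hxv' : CertLT ((findRankCertificate c V v).probed ∪ r'.2) x v :=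
          ((hc.certLT_pivot hv hxV).1 hxv).mono Finset.subset_union_left
        rcases lt_trichotomy u v with h' | rfl | h'
        · exact ((hcert u (Finset.mem_filter.2 ⟨hu, h'⟩)).2 h).mono Finset.subset_union_right
        · exact hxv'
        · exact hxv'.trans (((hc.certLT_pivot hv hu).2 h').mono Finset.subset_union_left)
    · rw [PMF.mem_support_pure_iff] at hr
      subst hr
      refine ⟨v, hv, rfl, ?_, fun u hu => hc.certLT_pivot hv hu⟩
      rw [h2, hlow]
      rw [← Finset.card_insert_of_notMem (a := v) (by simp)]
      congr 1
      ext u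
      simp only [Finset.mem_filter, Finset.mem_insert, le_iff_eq_or_lt]
      constructor
      · tauto
      · rintro (rfl | h) <;> tauto
    · obtain ⟨r', hr', rfl⟩ := (PMF.mem_support_map_iff _ _ _).1 hr
      rw [hlow] at h1 h2
      obtain ⟨x, hx, hrx, hcx, hcert⟩ := ih _ (card_upper_lt c V ⟨v, hv⟩) _
        (k - (findRankCertificate c V v).lower.card - 1) (by rw [hlow]; omega)
        (by simp only [hlow, hupp]; omega) rfl r' hr'
      rw [hupp] at hx hcx hcert
      obtain ⟨hxV, hxv⟩ := Finset.mem_filter.1 hx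
      refine ⟨x, hxV, hrx, ?_, fun u hu => ⟨fun h => ?_, fun h => ?_⟩⟩
      · have h3 : V.filter (· ≤ x) = (insert v (V.filter (· < v))) ∪
            ((V.filter (v < ·)).filter (· ≤ x)) := by
          ext u
          simp only [Finset.mem_filter, Finset.mem_insert, Finset.mem_union]
          constructor
          · rintro ⟨h, h'⟩
            rcases lt_trichotomy u v with h'' | h'' | h'' <;> tauto
          · rintro ((rfl | h) | h)
            · exact ⟨hv, hxv.le⟩
            · exact ⟨h.1, (h.2.trans hxv).le⟩
            · exact ⟨h.1.1, h.2⟩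
        rw [h3, Finset.card_union_of_disjoint, Finset.card_insert_of_notMem (by simp), hcx, hlow]
        · omega
        · rw [Finset.disjoint_left]
          intro u h h'
          simp only [Finset.mem_filter, Finset.mem_insert] at h h'
          rcases h with rfl | h
          · exact lt_irrefl _ h'.1.2
          · exact lt_asymm h.2 h'.1.2
      · have hxv' : CertLT ((findRankCertificate c V v).probed ∪ r'.2) v x :=
          ((hc.certLT_pivot hv hxV).2 hxv).mono Finset.subset_union_left
        rcases lt_trichotomy u v with h' | rfl | h'
        · exact (((hc.certLT_pivot hv hu).1 h').mono Finset.subset_union_left).trans hxv'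
        · exact hxv'
        · exact ((hcert u (Finset.mem_filter.2 ⟨hu, h'⟩)).1 h).mono Finset.subset_union_right
      · exact ((hcert u (Finset.mem_filter.2 ⟨hu, hxv.trans h⟩)).2 h).mono
          Finset.subset_union_right

theorem UnitCosts.uniformSort_correct {c : Sym2 E → ℝ} (hc : UnitCosts c) (V : Finset E) :
    ∀ r ∈ (uniformSort c V).support, r.1.Pairwise (· < ·) ∧ (∀ x, x ∈ r.1 ↔ x ∈ V) ∧
      ∀ a ∈ V, ∀ b ∈ V, a < b → CertLT r.2 a b := by
  induction hn : V.card using Nat.strong_induction_on generalizing V with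
  | _ n ih =>
    subst hn
    intro r hr
    rw [uniformSort] at hr
    split_ifs at hr with hV
    · obtain ⟨⟨v, hv⟩, -, hr⟩ := (PMF.mem_support_bind_iff _ _ _).1 hr
      obtain ⟨r₁, hr₁, hr⟩ := (PMF.mem_support_bind_iff _ _ _).1 hr
      obtain ⟨r₂, hr₂, rfl⟩ := (PMF.mem_support_map_iff _ _ _).1 hr
      obtain ⟨hs₁, hm₁, hc₁⟩ := ih _ (card_lower_lt c V ⟨v, hv⟩) _ rfl r₁ hr₁
      obtain ⟨hs₂, hm₂, hc₂⟩ := ih _ (card_upper_lt c V ⟨v, hv⟩) _ rfl r₂ hr₂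
      simp only [hc.lower_eq hv, hc.upper_eq hv, Finset.mem_filter] at hm₁ hm₂ hc₁ hc₂
      have key : ∀ a ∈ V, (a < v → CertLT ((findRankCertificate c V v).probed ∪ r₁.2 ∪ r₂.2) a v) ∧
          (v < a → CertLT ((findRankCertificate c V v).probed ∪ r₁.2 ∪ r₂.2) v a) := fun a ha =>
        have hsub := Finset.subset_union_left.trans (Finset.subset_union_left
          (s₁ := (findRankCertificate c V v).probed ∪ r₁.2) (s₂ := r₂.2))
        ⟨fun h => ((hc.certLT_pivot hv ha).1 h).mono hsub,
          fun h => ((hc.certLT_pivot hv ha).2 h).mono hsub⟩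
      refine ⟨?_, fun x => ?_, fun a ha b hb hab => ?_⟩
      · simp only [List.pairwise_append, List.pairwise_cons, List.mem_cons]
        refine ⟨hs₁, ⟨fun a ha => ((hm₂ a).1 ha).2, hs₂⟩, ?_⟩
        rintro a ha b (rfl | hb)
        · exact ((hm₁ a).1 ha).2
        · exact ((hm₁ a).1 ha).2.trans ((hm₂ b).1 hb).2
      · simp only [List.mem_append, List.mem_cons, hm₁, hm₂]
        constructor
        · rintro (h | rfl | h)
          exacts [h.1, hv, h.1]
        · intro h
          rcases lt_trichotomy x v with h' | h' | h' <;> tauto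
      · rcases lt_trichotomy a v with hav | rfl | hav
        · rcases lt_trichotomy b v with hbv | rfl | hbv
          · exact (hc₁ a ⟨ha, hav⟩ b ⟨hb, hbv⟩ hab).mono
              (Finset.subset_union_right.trans Finset.subset_union_left)
          · exact (key a ha).1 hav
          · exact ((key a ha).1 hav).trans ((key b hb).2 hbv)
        · exact (key b hb).2 hab
        · exact (hc₂ a ⟨ha, hav⟩ b ⟨hb, hav.trans hab⟩ hab).mono Finset.subset_union_right
    · rw [PMF.mem_support_pure_iff] at hr
      subst hr
      rw [Finset.not_nonempty_iff_eq_empty] at hV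
      simp [hV]

/-- Consecutive entries of an exhaustive increasing list have nothing between them, and a certified
path across such a pair is a single edge. -/
theorem isSortingCertificate_of_certLT {P : Finset (Sym2 E)} {L : List E}
    (hs : L.Pairwise (· < ·)) (hm : ∀ x, x ∈ L) (hP : ∀ a b, a < b → CertLT P a b) :
    IsSortingCertificate P L := by
  rw [IsSortingCertificate, List.isChain_iff_getElem]
  intro i hi
  have hmono : ∀ (a b : ℕ) (ha : a < L.length) (hb : b < L.length), a < b → L[a] < L[b] :=
    List.pairwise_iff_getElem.1 hs
  have hlt := hmono i (i + 1) (by omega) hi (by omega)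
  refine ⟨(hP _ _ hlt).mem_of_covBy ⟨hlt, fun x h1 h2 => ?_⟩, hlt⟩
  obtain ⟨j, hj, rfl⟩ := List.getElem_of_mem (hm x)
  rcases lt_trichotomy j i with h | rfl | h
  · exact lt_asymm h1 (hmono j i hj _ h)
  · exact lt_irrefl _ h1
  · rcases (Nat.succ_le_of_lt h).eq_or_lt with h | h
    · simp only [← h] at h2
      exact lt_irrefl _ h2
    · exact lt_asymm h2 (hmono _ j _ hj h)

end

/-! ### Uniform costs and the exploration from the pivot -/

section

/-- The uniform distribution on `[0, 1]`. -/
noncomputable def unitLaw : Measure ℝ := volume.restrict (Set.Icc (0 : ℝ) 1)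

instance : IsProbabilityMeasure unitLaw := ⟨by simp [unitLaw]⟩

theorem unitLaw_Iic_le (t : ℝ) : unitLaw (Set.Iic t) ≤ ENNReal.ofReal t := by
  rw [unitLaw, Measure.restrict_apply measurableSet_Iic]
  calc volume (Set.Iic t ∩ Set.Icc 0 1) ≤ volume (Set.Icc 0 t) :=
        measure_mono fun x hx => ⟨hx.2.1, hx.1⟩
    _ = _ := by simp

theorem unitLaw_Ioi {q : ℝ} (h0 : 0 ≤ q) : unitLaw (Set.Ioi q) = ENNReal.ofReal (1 - q) := by
  rw [unitLaw, Measure.restrict_apply measurableSet_Ioi]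
  have : Set.Ioi q ∩ Set.Icc 0 1 = Set.Ioc q 1 := by
    ext x
    simp only [Set.mem_inter_iff, Set.mem_Ioi, Set.mem_Icc, Set.mem_Ioc]
    exact ⟨fun h => ⟨h.1, h.2.2⟩, fun h => ⟨h.1, (h0.trans h.1.le), h.2⟩⟩
  simp [this]

/-- Both functions factor through disjoint blocks of coordinates; extending a block by `0` makes the
factor maps explicit and measurable. -/
theorem indepFun_of_dependsOn {ι : Type*} [Fintype ι] {μ : ι → Measure ℝ}
    [∀ i, IsProbabilityMeasure (μ i)] {β γ : Type*} [MeasurableSpace β] [MeasurableSpace γ]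
    {X : (ι → ℝ) → β} {Y : (ι → ℝ) → γ} (hX : Measurable X) (hY : Measurable Y)
    {A B : Finset ι} (hAB : Disjoint A B) (hXA : DependsOn X (A : Set ι))
    (hYB : DependsOn Y (B : Set ι)) : IndepFun X Y (Measure.pi μ) := by
  classical
  have h := (iIndepFun_pi (μ := μ) (X := fun _ => id)
    (fun _ => aemeasurable_id)).indepFun_finset A B hAB (fun i => measurable_pi_apply i)
  let ext (C : Finset ι) (z : C → ℝ) : ι → ℝ := fun i => if hi : i ∈ C then z ⟨i, hi⟩ else 0
  have hext (C : Finset ι) : Measurable (ext C) := by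
    refine measurable_pi_lambda _ fun i => ?_
    by_cases hi : i ∈ C
    · simp only [ext, hi, dif_pos]
      exact measurable_pi_apply _
    · simp only [ext, hi, dif_neg, not_false_eq_true]
      exact measurable_const
  have h2 := h.comp (φ := fun z => X (ext A z)) (ψ := fun z => Y (ext B z))
    (hX.comp (hext A)) (hY.comp (hext B))
  convert h2 using 1
  · funext x
    exact hXA fun i hi => by simp [ext, Finset.mem_coe.1 hi]
  · funext x
    exact hYB fun i hi => by simp [ext, Finset.mem_coe.1 hi]

variable {E : Type*} [LinearOrder E]

/-- Costs of the comparisons of two distinct elements. -/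
abbrev EdgeCosts (E : Type*) : Type _ := {e : Sym2 E // ¬ e.IsDiag} → ℝ

/-- The cost function that agrees with `x` on pairs of distinct elements and is `0` elsewhere. -/
def extendCosts (x : EdgeCosts E) : Sym2 E → ℝ := fun e => if h : e.IsDiag then 0 else x ⟨e, h⟩

theorem extendCosts_of_not_isDiag (x : EdgeCosts E) {e : Sym2 E} (h : ¬ e.IsDiag) :
    extendCosts x e = x ⟨e, h⟩ := dif_neg h

theorem measurable_extendCosts_apply (e : Sym2 E) :
    Measurable fun x : EdgeCosts E => extendCosts x e := by
  unfold extendCosts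
  split_ifs
  · exact measurable_const
  · exact measurable_pi_apply _

/-- The joint law of independent uniform costs. -/
noncomputable def costLaw (E : Type*) [Fintype E] [LinearOrder E] : Measure (EdgeCosts E) :=
  Measure.pi fun _ => unitLaw

instance [Fintype E] : IsProbabilityMeasure (costLaw E) := by unfold costLaw; infer_instance

/-- The number of entries `u` of the list that are not adjacent, by an edge of cost at most `q`,
to the set `S` increased by the earlier entries that were adjacent to it. -/
noncomputable def unreached (q : ℝ) (c : Sym2 E → ℝ) : Finset E → List E → ℕ
  | _, [] => 0
  | S, u :: l => if ∃ s ∈ S, c s(s, u) ≤ q then unreached q c (insert u S) l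
      else unreached q c S l + 1

theorem unreached_le_length (q : ℝ) (c : Sym2 E → ℝ) (S : Finset E) (l : List E) :
    unreached q c S l ≤ l.length := by
  induction l generalizing S with
  | nil => simp [unreached]
  | cons u l ih =>
    rw [unreached, List.length_cons]
    split_ifs
    · exact (ih _).trans (Nat.le_succ _)
    · exact Nat.succ_le_succ (ih _)

/-- Only pairs with an endpoint in the list are queried. This makes the exploration of a tail
independent of the edges that decided the head. -/
theorem unreached_congr {q : ℝ} {c c' : Sym2 E → ℝ} {S : Finset E} {l : List E} (hl : l.Nodup)
    (hS : ∀ u ∈ l, u ∉ S) (h : ∀ a b, a ≠ b → b ∈ l → c s(a, b) = c' s(a, b)) :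
    unreached q c S l = unreached q c' S l := by
  induction l generalizing S with
  | nil => rfl
  | cons u l ih =>
    have h1 : (∃ s ∈ S, c s(s, u) ≤ q) ↔ ∃ s ∈ S, c' s(s, u) ≤ q := by
      refine exists_congr fun s => and_congr_right fun hs => ?_
      rw [h s u (fun hsu => hS u (by simp) (hsu ▸ hs)) (by simp)]
    rw [List.nodup_cons] at hl
    have h2 : ∀ a b, a ≠ b → b ∈ l → c s(a, b) = c' s(a, b) :=
      fun a b hab hb => h a b hab (List.mem_cons_of_mem _ hb)
    simp only [unreached, h1]
    rw [ih hl.2 (fun a ha => hS a (List.mem_cons_of_mem _ ha)) h2, ih hl.2 (fun a ha => ?_) h2]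
    rw [Finset.mem_insert, not_or]
    exact ⟨fun h => hl.1 (h ▸ ha), hS a (List.mem_cons_of_mem _ ha)⟩

theorem measurableSet_exists_le (q : ℝ) (S : Finset E) (u : E) :
    MeasurableSet {x : EdgeCosts E | ∃ s ∈ S, extendCosts x s(s, u) ≤ q} := by
  have : {x : EdgeCosts E | ∃ s ∈ S, extendCosts x s(s, u) ≤ q} =
      ⋃ s ∈ S, {x | extendCosts x s(s, u) ≤ q} := by ext; simp
  rw [this]
  exact Finset.measurableSet_biUnion _ fun s _ =>
    measurableSet_le (measurable_extendCosts_apply _) measurable_const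

theorem measurable_unreached (q : ℝ) (S : Finset E) (l : List E) :
    Measurable fun x : EdgeCosts E => unreached q (extendCosts x) S l := by
  induction l generalizing S with
  | nil => exact measurable_const
  | cons u l ih =>
    simp only [unreached]
    exact Measurable.ite (measurableSet_exists_le q S u) (ih _) ((ih _).add_const 1)

/-! ### Moments of the number of unreached elements -/

section Moments

variable [Fintype E]

theorem integrable_unreached (q : ℝ) (S : Finset E) (l : List E) (φ : ℕ → ℝ) :
    Integrable (fun x => φ (unreached q (extendCosts x) S l)) (costLaw E) := by
  refine Integrable.of_bound (((measurable_of_countable φ).comp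
    (measurable_unreached q S l)).aestronglyMeasurable)
    (∑ i ∈ Finset.range (l.length + 1), |φ i|) (Filter.Eventually.of_forall fun x => ?_)
  exact Finset.single_le_sum (f := fun i => |φ i|) (fun i _ => abs_nonneg _)
    (Finset.mem_range.2 (Nat.lt_succ_of_le (unreached_le_length _ _ _ _)))

/-- The edges between `u` and the elements of `S`. -/
noncomputable def edgesTo (S : Finset E) (u : E) : Finset {e : Sym2 E // ¬ e.IsDiag} :=
  Finset.univ.filter fun e => ∃ s ∈ S, e.1 = s(s, u)

theorem card_edgesTo {S : Finset E} {u : E} (hu : u ∉ S) : (edgesTo S u).card = S.card := by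
  rw [← Finset.card_map (Function.Embedding.subtype _),
    ← Finset.card_image_of_injective S (f := fun s => s(s, u))]
  · congr 1
    ext e
    simp only [edgesTo, Finset.mem_map, Finset.mem_filter, Finset.mem_univ, true_and,
      Function.Embedding.coe_subtype, Finset.mem_image, Subtype.exists]
    constructor
    · rintro ⟨e', _, ⟨s, hs, rfl⟩, rfl⟩
      exact ⟨s, hs, rfl⟩
    · rintro ⟨s, hs, rfl⟩
      exact ⟨_, by simpa using fun h : s = u => hu (h ▸ hs), ⟨s, hs, rfl⟩, rfl⟩
  · intro a b h
    exact Sym2.congr_left.1 h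

theorem costLaw_forall_lt {q : ℝ} (h0 : 0 ≤ q) (h1 : q ≤ 1) {S : Finset E} {u : E} (hu : u ∉ S) :
    (costLaw E).real {x | ∃ s ∈ S, extendCosts x s(s, u) ≤ q}ᶜ = (1 - q) ^ S.card := by
  have hset : {x : EdgeCosts E | ∃ s ∈ S, extendCosts x s(s, u) ≤ q}ᶜ =
      Set.univ.pi fun e => if e ∈ edgesTo S u then Set.Ioi q else Set.univ := by
    ext x
    simp only [Set.mem_compl_iff, Set.mem_ofPred_eq, not_exists, not_and, not_le, Set.mem_pi,
      Set.mem_univ, true_implies]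
    constructor
    · intro h e
      split_ifs with he
      · obtain ⟨s, hs, hes⟩ := (Finset.mem_filter.1 he).2
        have := h s hs
        rw [← hes, extendCosts_of_not_isDiag x e.2] at this
        exact this
      · trivial
    · intro h s hs
      have hd : ¬ s(s, u).IsDiag := by simpa using fun h : s = u => hu (h ▸ hs)
      have := h ⟨s(s, u), hd⟩
      have hmem : (⟨s(s, u), hd⟩ : {e : Sym2 E // ¬ e.IsDiag}) ∈ edgesTo S u :=
        Finset.mem_filter.2 ⟨Finset.mem_univ _, s, hs, rfl⟩
      rw [if_pos hmem] at this
      rwa [extendCosts_of_not_isDiag x hd]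
  rw [hset, measureReal_def, costLaw, Measure.pi_pi]
  have : ∀ e, unitLaw (if e ∈ edgesTo S u then Set.Ioi q else Set.univ) =
      if e ∈ edgesTo S u then ENNReal.ofReal (1 - q) else 1 := by
    intro e
    split_ifs
    · exact unitLaw_Ioi h0
    · simp
  simp only [this, Finset.prod_ite_mem, Finset.univ_inter, Finset.prod_const, card_edgesTo hu,
    ENNReal.toReal_pow, ENNReal.toReal_ofReal (sub_nonneg.2 h1)]

/-- Whether `u` is reached depends on its edges to `S`. The continuation queries only edges with an
endpoint in `l`, which are different ones, so the expectation factors in each of the two cases. -/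
theorem integral_unreached_cons {q : ℝ} (h0 : 0 ≤ q) (h1 : q ≤ 1) {S : Finset E} {u : E}
    {l : List E} (hl : (u :: l).Nodup) (hS : ∀ a ∈ u :: l, a ∉ S) (φ : ℕ → ℝ) :
    ∫ x, φ (unreached q (extendCosts x) S (u :: l)) ∂(costLaw E) =
      (1 - (1 - q) ^ S.card) * ∫ x, φ (unreached q (extendCosts x) (insert u S) l) ∂(costLaw E) +
      (1 - q) ^ S.card * ∫ x, φ (unreached q (extendCosts x) S l + 1) ∂(costLaw E) := by
  have hu : u ∉ S := hS u (by simp)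
  rw [List.nodup_cons] at hl
  have hlS : ∀ a ∈ l, a ∉ S := fun a ha => hS a (List.mem_cons_of_mem _ ha)
  have hlS' : ∀ a ∈ l, a ∉ insert u S := fun a ha => by
    rw [Finset.mem_insert, not_or]
    exact ⟨fun h => hl.1 (h ▸ ha), hlS a ha⟩
  set A : Set (EdgeCosts E) := {x | ∃ s ∈ S, extendCosts x s(s, u) ≤ q} with hA
  have hAm : MeasurableSet A := measurableSet_exists_le q S u
  have hAc : (costLaw E).real Aᶜ = (1 - q) ^ S.card := costLaw_forall_lt h0 h1 hu
  have hAr : (costLaw E).real A = 1 - (1 - q) ^ S.card := by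
    rw [← hAc, probReal_compl_eq_one_sub hAm]; ring
  have hmemA : ∀ x y : EdgeCosts E, (∀ e ∈ edgesTo S u, x e = y e) → (x ∈ A ↔ y ∈ A) := by
    intro x y hxy
    refine exists_congr fun s => and_congr_right fun hs => ?_
    have hd : ¬ s(s, u).IsDiag := by simpa using fun h : s = u => hu (h ▸ hs)
    rw [extendCosts_of_not_isDiag x hd, extendCosts_of_not_isDiag y hd,
      hxy _ (Finset.mem_filter.2 ⟨Finset.mem_univ _, s, hs, rfl⟩)]
  have key : ∀ (B : Set (EdgeCosts E)), MeasurableSet B →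
      (∀ x y : EdgeCosts E, (∀ e ∈ edgesTo S u, x e = y e) → (x ∈ B ↔ y ∈ B)) →
      ∀ (T : Finset E), (∀ a ∈ l, a ∉ T) → ∀ ψ : ℕ → ℝ,
      ∫ x, B.indicator 1 x * ψ (unreached q (extendCosts x) T l) ∂(costLaw E) =
        (costLaw E).real B * ∫ x, ψ (unreached q (extendCosts x) T l) ∂(costLaw E) := by
    intro B hB hBdep T hT ψ
    have hm1 : Measurable (B.indicator (1 : EdgeCosts E → ℝ)) :=
      measurable_one.indicator hB
    have hm2 : Measurable fun x : EdgeCosts E => ψ (unreached q (extendCosts x) T l) :=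
      (measurable_of_countable ψ).comp (measurable_unreached q T l)
    have hind : IndepFun (B.indicator (1 : EdgeCosts E → ℝ))
        (fun x : EdgeCosts E => ψ (unreached q (extendCosts x) T l)) (costLaw E) := by
      refine indepFun_of_dependsOn hm1 hm2 (disjoint_compl_right (a := edgesTo S u)) ?_ ?_
      · intro x y hxy
        have := hBdep x y fun e he => hxy e he
        by_cases hx : x ∈ B
        · simp [hx, this.1 hx]
        · have hy : y ∉ B := fun h => hx (this.2 h)
          simp [hx, hy]
      · intro x y hxy
        refine congrArg ψ (unreached_congr hl.2 hT fun a b hab hb => ?_)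
        have hd : ¬ s(a, b).IsDiag := by simpa using hab
        rw [extendCosts_of_not_isDiag x hd, extendCosts_of_not_isDiag y hd]
        refine hxy _ ?_
        simp only [edgesTo, Finset.coe_compl, Finset.coe_filter, Finset.mem_univ, true_and,
          Set.mem_compl_iff, Set.mem_ofPred_eq, not_exists, not_and, Sym2.eq_iff, not_or]
        exact fun s hs => ⟨fun _ h => hl.1 (h ▸ hb), fun _ h => hlS b hb (h ▸ hs)⟩
    rw [hind.integral_fun_mul_eq_mul_integral hm1.aestronglyMeasurable hm2.aestronglyMeasurable,
      integral_indicator_one hB]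
  have hsplit : ∀ x, φ (unreached q (extendCosts x) S (u :: l)) =
      A.indicator 1 x * φ (unreached q (extendCosts x) (insert u S) l) +
      Aᶜ.indicator 1 x * (fun i => φ (i + 1)) (unreached q (extendCosts x) S l) := by
    intro x
    by_cases hx : x ∈ A
    · have hx' : ∃ s ∈ S, extendCosts x s(s, u) ≤ q := hx
      simp [unreached, hx, hx']
    · have hx' : ¬ ∃ s ∈ S, extendCosts x s(s, u) ≤ q := hx
      simp only [unreached, if_neg hx']
      simp [hx]
  simp_rw [hsplit]
  rw [integral_add, key A hAm hmemA _ hlS', key Aᶜ hAm.compl (fun x y h => not_congr (hmemA x y h))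
    _ hlS (fun i => φ (i + 1)), hAr, hAc]
  · have := (integrable_unreached q (insert u S) l φ).indicator hAm
    refine this.congr (Filter.Eventually.of_forall fun x => ?_)
    by_cases hx : x ∈ A <;> simp [hx]
  · have := (integrable_unreached q S l fun i => φ (i + 1)).indicator hAm.compl
    refine this.congr (Filter.Eventually.of_forall fun x => ?_)
    by_cases hx : x ∈ A <;> simp [hx]

/-- Bound for the expected number of unreached elements when `k` elements have been reached and
at most `N` can be. -/
noncomputable def unreachedBound (q : ℝ) (N k : ℕ) : ℝ := ∑ j ∈ Finset.Icc k N, 1 / (q * j)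

theorem unreachedBound_nonneg {q : ℝ} (hq : 0 < q) (N k : ℕ) : 0 ≤ unreachedBound q N k :=
  Finset.sum_nonneg fun j _ => by positivity

theorem unreachedBound_eq_add {q : ℝ} {N k : ℕ} (hk : k ≤ N) :
    unreachedBound q N k = 1 / (q * k) + unreachedBound q N (k + 1) := by
  rw [unreachedBound, ← Finset.insert_Icc_add_one_left_eq_Icc hk, Finset.sum_insert (by simp)]
  rfl

/-- Bernoulli's inequality for `(1 + q) ^ k` together with `(1 - q) * (1 + q) ≤ 1`. It says that the
odds of a miss against a hit are at most `1 / (q k)`. -/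
theorem one_sub_pow_mul_le {q : ℝ} (h0 : 0 < q) (h1 : q ≤ 1) (k : ℕ) :
    (1 - q) ^ k * (1 + q * k) ≤ 1 := by
  have h2 : 1 + (k : ℝ) * q ≤ (1 + q) ^ k := one_add_mul_le_pow (by linarith) k
  calc (1 - q) ^ k * (1 + q * k) ≤ (1 - q) ^ k * (1 + q) ^ k :=
        mul_le_mul_of_nonneg_left (by linarith) (pow_nonneg (by linarith) k)
    _ = (1 - q ^ 2) ^ k := by rw [← mul_pow]; ring
    _ ≤ 1 := pow_le_one₀ (by nlinarith) (by nlinarith)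

/-- The odds bound for a miss with `k` elements reached is one term of the sum, so the first moment
closes under one exploration step. The form `g + 2 g²` is what closes for the second moment. Fixing
`N` makes the bound a tail of one sum, with `k ≤ N` as long as the list is nonempty. -/
theorem integral_unreached_le {q : ℝ} (h0 : 0 < q) (h1 : q ≤ 1) {N : ℕ} (l : List E)
    (S : Finset E) (hl : l.Nodup) (hlS : ∀ a ∈ l, a ∉ S) (hS : 1 ≤ S.card)
    (hN : S.card + l.length ≤ N + 1) :
    ∫ x, (unreached q (extendCosts x) S l : ℝ) ∂(costLaw E) ≤ unreachedBound q N S.card ∧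
    ∫ x, (unreached q (extendCosts x) S l : ℝ) ^ 2 ∂(costLaw E) ≤
      unreachedBound q N S.card + 2 * unreachedBound q N S.card ^ 2 := by
  induction l generalizing S with
  | nil =>
    have := unreachedBound_nonneg h0 N S.card
    simp only [unreached, Nat.cast_zero, integral_zero, ne_eq, OfNat.ofNat_ne_zero,
      not_false_eq_true, zero_pow]
    exact ⟨this, by positivity⟩
  | cons u l ih =>
    have hu : u ∉ S := hlS u (by simp)
    have hl' := List.nodup_cons.1 hl
    have hlS0 : ∀ a ∈ l, a ∉ S := fun a ha => hlS a (List.mem_cons_of_mem _ ha)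
    have hlS' : ∀ a ∈ l, a ∉ insert u S := fun a ha => by
      rw [Finset.mem_insert, not_or]
      exact ⟨fun h => hl'.1 (h ▸ ha), hlS0 a ha⟩
    rw [List.length_cons] at hN
    obtain ⟨hi1, hi2⟩ := ih S hl'.2 hlS0 hS (by omega)
    obtain ⟨hj1, hj2⟩ := ih (insert u S) hl'.2 hlS'
      (by rw [Finset.card_insert_of_notMem hu]; omega)
      (by rw [Finset.card_insert_of_notMem hu]; omega)
    rw [Finset.card_insert_of_notMem hu] at hj1 hj2
    have hI1 := integral_unreached_cons h0.le h1 hl hlS (fun i => (i : ℝ))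
    have hI2 := integral_unreached_cons h0.le h1 hl hlS (fun i => (i : ℝ) ^ 2)
    have hint1 := integrable_unreached (E := E) q S l (fun i => (i : ℝ))
    have hint2 := integrable_unreached (E := E) q S l (fun i => (i : ℝ) ^ 2)
    have hE1 : ∫ x, ((unreached q (extendCosts x) S l + 1 : ℕ) : ℝ) ∂(costLaw E) =
        ∫ x, (unreached q (extendCosts x) S l : ℝ) ∂(costLaw E) + 1 := by
      simp only [Nat.cast_add, Nat.cast_one]
      rw [integral_add hint1 (integrable_const _)]
      simp
    have hE2 : ∫ x, ((unreached q (extendCosts x) S l + 1 : ℕ) : ℝ) ^ 2 ∂(costLaw E) =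
        ∫ x, (unreached q (extendCosts x) S l : ℝ) ^ 2 ∂(costLaw E) +
        2 * ∫ x, (unreached q (extendCosts x) S l : ℝ) ∂(costLaw E) + 1 := by
      have : ∀ x : EdgeCosts E, ((unreached q (extendCosts x) S l + 1 : ℕ) : ℝ) ^ 2 =
        ((unreached q (extendCosts x) S l : ℝ) ^ 2 +
          2 * (unreached q (extendCosts x) S l : ℝ)) + 1 := fun x => by push_cast; ring
      simp_rw [this]
      have hint3 : Integrable (fun x : EdgeCosts E => (unreached q (extendCosts x) S l : ℝ) ^ 2 +
          2 * (unreached q (extendCosts x) S l : ℝ)) (costLaw E) := hint2.add (hint1.const_mul 2)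
      rw [integral_add hint3 (integrable_const _),
        integral_add hint2 (hint1.const_mul 2), integral_const_mul]
      simp
    rw [hE1] at hI1
    rw [hE2] at hI2
    rw [hI1, hI2]
    have hg := unreachedBound_eq_add (q := q) (N := N) (k := S.card) (by omega)
    have hg0 := unreachedBound_nonneg h0 N (S.card + 1)
    have hqk : 0 < q * S.card := mul_pos h0 (by exact_mod_cast hS)
    have hs := one_sub_pow_mul_le h0 h1 S.card
    have hs0 : 0 ≤ (1 - q) ^ S.card := pow_nonneg (by linarith) _
    have hs1 : (1 - q) ^ S.card ≤ 1 := pow_le_one₀ (by linarith) (by linarith)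
    have hd0 : 0 < 1 / (q * (S.card : ℝ)) := by positivity
    generalize unreachedBound q N S.card = g at *
    generalize unreachedBound q N (S.card + 1) = g' at *
    generalize (1 - q) ^ S.card = s at *
    have hsd : s ≤ (1 - s) * (1 / (q * S.card)) := by
      rw [mul_one_div, le_div_iff₀ hqk]; linarith
    generalize 1 / (q * (S.card : ℝ)) = d at *
    generalize ∫ x, (unreached q (extendCosts x) S l : ℝ) ^ 2 ∂(costLaw E) = I2 at *
    generalize ∫ x, (unreached q (extendCosts x) S l : ℝ) ∂(costLaw E) = I1 at *
    generalize ∫ x, (unreached q (extendCosts x) (insert u S) l : ℝ) ^ 2 ∂(costLaw E) = J2 at *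
    generalize ∫ x, (unreached q (extendCosts x) (insert u S) l : ℝ) ∂(costLaw E) = J1 at *
    have h1s : 0 ≤ 1 - s := by linarith
    constructor
    · have e1 := mul_le_mul_of_nonneg_left hj1 h1s
      have e2 := mul_le_mul_of_nonneg_left hi1 hs0
      rw [hg] at e2 ⊢
      nlinarith
    · have e1 := mul_le_mul_of_nonneg_left hj2 h1s
      have e2 := mul_le_mul_of_nonneg_left hi1 hs0
      have e3 := mul_le_mul_of_nonneg_left hi2 hs0
      have hgp : 0 ≤ 1 + 2 * g := by linarith
      have e4 := mul_le_mul_of_nonneg_right hsd hgp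
      -- After `e4` absorbs the contribution `s * (1 + 2 * g)` of a miss, this is exactly the slack
      -- left in the second moment step.
      have e5 : 0 ≤ (1 - s) * d * (2 * g') := by positivity
      have e6 : g' = g - d := by linarith
      subst e6
      nlinarith

theorem unreachedBound_one_le {q : ℝ} (h0 : 0 < q) (N : ℕ) :
    unreachedBound q N 1 ≤ (1 + Real.log N) / q := by
  have : unreachedBound q N 1 = (harmonic N : ℚ) / q := by
    rw [unreachedBound, harmonic_eq_sum_Icc]
    push_cast
    rw [Finset.sum_div]
    refine Finset.sum_congr rfl fun j _ => ?_
    rw [one_div, mul_inv, mul_comm]; rfl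
  rw [this]
  exact div_le_div_of_nonneg_right (harmonic_le_one_add_log N) h0.le

theorem integral_unreached_sq_le {q : ℝ} (h0 : 0 < q) (h1 : q ≤ 1) {n : ℕ} {l : List E}
    {v : E} (hl : (v :: l).Nodup) (hn : l.length ≤ n) :
    ∫ x, (unreached q (extendCosts x) {v} l : ℝ) ^ 2 ∂(costLaw E) ≤
      3 * ((1 + Real.log n) / q) ^ 2 := by
  rw [List.nodup_cons] at hl
  have h := (integral_unreached_le h0 h1 (N := n) l {v} hl.2
    (fun a ha => by rw [Finset.mem_singleton]; exact fun h => hl.1 (h ▸ ha)) (by simp)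
    (by simp; omega)).2
  rw [Finset.card_singleton] at h
  have hb := unreachedBound_one_le h0 n
  have hb0 := unreachedBound_nonneg h0 n 1
  -- Since `q ≤ 1`, the bound `G` for the mean is at least `1`, so `G + 2 G² ≤ 3 G²`.
  have hG : 1 ≤ (1 + Real.log n) / q := by
    rw [le_div_iff₀ h0]
    linarith [Real.log_natCast_nonneg n]
  nlinarith

end Moments

end

/-! ### Resampling of costs above a threshold -/

section

section Resampling

/-- Replace a value `a` above `p` by a rescaled copy of the fresh value `b`. -/
noncomputable def resampleAbove (p a b : ℝ) : ℝ := if a < p then a else p + (1 - p) * b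

theorem measurable_resampleAbove (p : ℝ) :
    Measurable fun z : ℝ × ℝ => resampleAbove p z.1 z.2 := by
  unfold resampleAbove
  exact Measurable.ite (measurableSet_lt measurable_fst measurable_const) measurable_fst
    (by fun_prop)

/-- A uniform value conditioned to be at least `p` is uniform on `[p, 1]`, which is the law of `p +
(1 - p) * b`; values below `p` are untouched. -/
theorem measurePreserving_resampleAbove {p : ℝ} (h0 : 0 ≤ p) (h1 : p < 1) :
    MeasurePreserving (fun z : ℝ × ℝ => resampleAbove p z.1 z.2) (unitLaw.prod unitLaw)
      unitLaw := by
  refine ⟨measurable_resampleAbove p, ?_⟩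
  ext A hA
  rw [Measure.map_apply (measurable_resampleAbove p) hA]
  set g : ℝ → ℝ := fun b => p + (1 - p) * b with hg
  have hgm : Measurable g := by fun_prop
  have hset : (fun z : ℝ × ℝ => resampleAbove p z.1 z.2) ⁻¹' A =
      ((A ∩ Set.Iio p) ×ˢ Set.univ) ∪ (Set.Ici p ×ˢ (g ⁻¹' A)) := by
    ext ⟨a, b⟩
    by_cases h : a < p
    · simp [resampleAbove, h, not_le.2 h]
    · simp [resampleAbove, h, not_lt.1 h, hg]
  have hdisj : Disjoint ((A ∩ Set.Iio p) ×ˢ (Set.univ : Set ℝ)) (Set.Ici p ×ˢ (g ⁻¹' A)) := by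
    rw [Set.disjoint_left]
    rintro ⟨a, b⟩ h h'
    exact absurd h.1.2 (not_lt.2 (show p ≤ a from h'.1))
  have h1p : 0 < 1 - p := by linarith
  have hIci : unitLaw (Set.Ici p) = ENNReal.ofReal (1 - p) := by
    rw [unitLaw, Measure.restrict_apply measurableSet_Ici]
    have : Set.Ici p ∩ Set.Icc 0 1 = Set.Icc p 1 := by
      ext x
      simp only [Set.mem_inter_iff, Set.mem_Ici, Set.mem_Icc]
      exact ⟨fun h => ⟨h.1, h.2.2⟩, fun h => ⟨h.1, h0.trans h.1, h.2⟩⟩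
    simp [this]
  have hpre : unitLaw (g ⁻¹' A) = ENNReal.ofReal (1 - p)⁻¹ * volume (A ∩ Set.Icc p 1) := by
    rw [unitLaw, Measure.restrict_apply (hgm hA)]
    have : g ⁻¹' A ∩ Set.Icc 0 1 =
        ((1 - p) * ·) ⁻¹' ((p + ·) ⁻¹' (A ∩ Set.Icc p 1)) := by
      ext x
      simp only [Set.mem_inter_iff, Set.mem_preimage, Set.mem_Icc, hg]
      refine and_congr_right fun _ => ⟨fun h => ⟨?_, ?_⟩, fun h => ⟨?_, ?_⟩⟩
      · nlinarith [h.1]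
      · nlinarith [h.2]
      · exact nonneg_of_mul_nonneg_right (by linarith [h.1]) h1p
      · exact le_of_mul_le_mul_left (by linarith [h.2]) h1p
    rw [this, Real.volume_preimage_mul_left h1p.ne', measure_preimage_add, abs_of_pos
      (inv_pos.2 h1p)]
  rw [hset, measure_union hdisj (measurableSet_Ici.prod (hgm hA)), Measure.prod_prod,
    Measure.prod_prod, hIci, hpre, measure_univ, mul_one, ← mul_assoc,
    ← ENNReal.ofReal_mul h1p.le, mul_inv_cancel₀ h1p.ne', ENNReal.ofReal_one, one_mul,
    unitLaw, Measure.restrict_apply (hA.inter measurableSet_Iio), Measure.restrict_apply hA,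
    ← measure_union _ (hA.inter measurableSet_Icc)]
  · congr 1
    ext x
    simp only [Set.mem_union, Set.mem_inter_iff, Set.mem_Iio, Set.mem_Icc]
    constructor
    · rintro (⟨⟨h, h'⟩, h''⟩ | ⟨h, h'⟩)
      · exact ⟨h, h''⟩
      · exact ⟨h, h0.trans h'.1, h'.2⟩
    · rintro ⟨h, h'⟩
      by_cases hx : x < p
      · exact Or.inl ⟨⟨h, hx⟩, h'⟩
      · exact Or.inr ⟨h, not_lt.1 hx, h'.2⟩
  · rw [Set.disjoint_left]
    exact fun x h h' => (not_lt.2 h'.2.1) h.1.2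

end Resampling

variable {E : Type*} [LinearOrder E]

/-- Resample independently all costs above `p`. -/
noncomputable def resampleCosts (p : ℝ) (x y : EdgeCosts E) : EdgeCosts E :=
  fun e => resampleAbove p (x e) (y e)

theorem measurePreserving_resampleCosts [Fintype E] {p : ℝ} (h0 : 0 ≤ p) (h1 : p < 1) :
    MeasurePreserving (fun z : EdgeCosts E × EdgeCosts E => resampleCosts p z.1 z.2)
      ((costLaw E).prod (costLaw E)) (costLaw E) := by
  have hA := measurePreserving_arrowProdEquivProdArrow ℝ ℝ {e : Sym2 E // ¬ e.IsDiag}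
    (fun _ => unitLaw) (fun _ => unitLaw)
  have hB := measurePreserving_pi (ι := {e : Sym2 E // ¬ e.IsDiag})
    (fun _ => unitLaw.prod unitLaw) (fun _ => unitLaw)
    (fun _ => measurePreserving_resampleAbove h0 h1)
  exact hB.comp hA.symm

/-! ### Measurability of the pivot routine in the costs -/

section Measurability

instance : MeasurableSpace (PivotState E) := ⊤

instance : DiscreteMeasurableSpace (PivotState E) :=
  ⟨fun _ => MeasurableSpace.measurableSet_top⟩

instance [Finite E] : Finite (PivotState E) :=
  Finite.of_injective (β := Finset E × Finset E × Finset E × Finset (Sym2 E))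
    (fun s => (s.rem, s.lower, s.upper, s.probed)) fun s t h => by
      cases s; cases t; simpa using h

theorem measurable_comparisonsIn (V : Finset E) (lo hi : ℝ) :
    Measurable fun x : EdgeCosts E => comparisonsIn (extendCosts x) V lo hi := by
  rw [measurable_finset_iff]
  intro e
  simp only [mem_comparisonsIn]
  have hm := measurable_extendCosts_apply (E := E) e
  exact measurable_const.and (measurable_const.and
    ((measurableSet_setOfPred.1 (measurableSet_le measurable_const hm)).and
      (measurableSet_setOfPred.1 (measurableSet_le hm measurable_const))))

theorem measurable_pivotRound [Finite E] (v : E) (s : PivotState E) (lo hi : ℝ) :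
    Measurable fun x : EdgeCosts E => pivotRound (extendCosts x) v s lo hi :=
  (measurable_of_countable fun Q : Finset (Sym2 E) => (⟨
    {u ∈ s.rem | ¬ CertLT (s.probed ∪ Q) u v ∧ ¬ CertLT (s.probed ∪ Q) v u},
    s.lower ∪ {u ∈ s.rem | CertLT (s.probed ∪ Q) u v},
    s.upper ∪ {u ∈ s.rem | CertLT (s.probed ∪ Q) v u},
    s.probed ∪ Q⟩ : PivotState E)).comp (measurable_comparisonsIn s.rem lo hi)

theorem measurable_pivotState [Finite E] (V : Finset E) (v : E) (i : ℕ) :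
    Measurable fun x : EdgeCosts E => pivotState (extendCosts x) V v i := by
  induction i with
  | zero => exact measurable_pivotRound v _ _ _
  | succ i ih =>
    have h : Measurable fun z : PivotState E × EdgeCosts E =>
        pivotRound (extendCosts z.2) v z.1 (threshold V.card i) (threshold V.card (i + 1)) :=
      measurable_from_prod_countable_right fun s => measurable_pivotRound v s _ _
    simp only [pivotState_succ]
    exact h.comp (f := fun x => (pivotState (extendCosts x) V v i, x)) (ih.prodMk measurable_id)

theorem measurable_comp_pivotState [Finite E] {β : Type*} [MeasurableSpace β]
    (f : PivotState E → β) (V : Finset E) (v : E) (i : ℕ) :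
    Measurable fun x : EdgeCosts E => f (pivotState (extendCosts x) V v i) :=
  (Measurable.of_discrete (f := f)).comp (measurable_pivotState V v i)

end Measurability

theorem comparisonsIn_congr {c c' : Sym2 E → ℝ} {V : Finset E} {lo hi t : ℝ} (ht : hi ≤ t)
    (h : ∀ e : Sym2 E, ¬ e.IsDiag → c e = c' e ∨ (t < c e ∧ t < c' e)) :
    comparisonsIn c V lo hi = comparisonsIn c' V lo hi := by
  ext e
  simp only [mem_comparisonsIn]
  refine and_congr_right fun _ => and_congr_right fun hd => ?_
  rcases h e hd with h | ⟨h, h'⟩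
  · rw [h]
  · exact ⟨fun h'' => absurd (h''.2.trans ht) (not_le.2 h),
      fun h'' => absurd (h''.2.trans ht) (not_le.2 h')⟩

theorem pivotRound_congr {c c' : Sym2 E → ℝ} {v : E} {s : PivotState E} {lo hi : ℝ}
    (h : comparisonsIn c s.rem lo hi = comparisonsIn c' s.rem lo hi) :
    pivotRound c v s lo hi = pivotRound c' v s lo hi := by
  simp only [pivotRound, h]

/-- The rounds up to `i` only compare costs with bounds at most `t`, so a cost above `t` may be
moved freely above `t`. -/
theorem pivotState_congr {c c' : Sym2 E → ℝ} {V : Finset E} {v : E} {t : ℝ} {i : ℕ}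
    (ht : threshold V.card i ≤ t)
    (h : ∀ e : Sym2 E, ¬ e.IsDiag → c e = c' e ∨ (t < c e ∧ t < c' e)) :
    pivotState c V v i = pivotState c' V v i := by
  induction i with
  | zero => exact pivotRound_congr (comparisonsIn_congr (by rwa [← threshold_zero]) h)
  | succ i ih =>
    rw [pivotState_succ, pivotState_succ,
      ih ((threshold_mono _ (Nat.le_succ i)).trans ht)]
    exact pivotRound_congr (comparisonsIn_congr ht h)

/-! ### Remaining elements are unreached by the exploration -/

section Reachability

/-- Each element reached by the exploration inherits `Good` along the cheap edge that reached it.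
The relation `r` is the direction of the scan, which makes that edge extend a directed path. -/
theorem length_filter_not_le_unreached {q : ℝ} {c : Sym2 E → ℝ} {r : E → E → Prop}
    {Good : E → Prop} [DecidablePred Good] {W : Finset E}
    (step : ∀ a ∈ W, ∀ u ∈ W, Good a → r a u → c s(a, u) ≤ q → Good u)
    (l : List E) (S : Finset E) (hSW : S ⊆ W) (hlW : ∀ u ∈ l, u ∈ W) (hS : ∀ s ∈ S, Good s)
    (hSl : ∀ s ∈ S, ∀ u ∈ l, r s u) (hl : l.Pairwise r) :
    (l.filter (fun u => ¬ Good u)).length ≤ unreached q c S l := by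
  induction l generalizing S with
  | nil => simp
  | cons u l ih =>
    rw [List.pairwise_cons] at hl
    have hlW' : ∀ a ∈ l, a ∈ W := fun a ha => hlW a (List.mem_cons_of_mem _ ha)
    have hSl' : ∀ s ∈ S, ∀ a ∈ l, r s a := fun s hs a ha => hSl s hs a (List.mem_cons_of_mem _ ha)
    rw [unreached]
    split_ifs with h
    · obtain ⟨s, hs, hsu⟩ := h
      have hu : Good u := step s (hSW hs) u (hlW u (by simp)) (hS s hs) (hSl s hs u (by simp)) hsu
      rw [List.filter_cons_of_neg (by simpa using hu)]
      refine ih _ (Finset.insert_subset (hlW u (by simp)) hSW) hlW' ?_ ?_ hl.2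
      · intro s hs
        rcases Finset.mem_insert.1 hs with rfl | hs
        exacts [hu, hS s hs]
      · intro s hs
        rcases Finset.mem_insert.1 hs with rfl | hs
        exacts [hl.1, hSl' s hs]
    · have := ih S hSW hlW' hS hSl' hl.2
      rw [List.filter_cons]
      split_ifs
      · rw [List.length_cons]; omega
      · omega

/-- The elements of `W` above `v`, in increasing order. -/
def listAbove (W : Finset E) (v : E) : List E := (W.filter (v < ·)).sort (· ≤ ·)

/-- The elements of `W` below `v`, in decreasing order. -/
def listBelow (W : Finset E) (v : E) : List E := (W.filter (· < v)).sort (· ≥ ·)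

theorem mem_listAbove {W : Finset E} {v u : E} : u ∈ listAbove W v ↔ u ∈ W ∧ v < u := by
  simp [listAbove]

theorem mem_listBelow {W : Finset E} {v u : E} : u ∈ listBelow W v ↔ u ∈ W ∧ u < v := by
  simp [listBelow]

theorem length_listAbove_le (W : Finset E) (v : E) : (listAbove W v).length ≤ W.card := by
  rw [listAbove, Finset.length_sort]
  exact Finset.card_filter_le _ _

theorem length_listBelow_le (W : Finset E) (v : E) : (listBelow W v).length ≤ W.card := by
  rw [listBelow, Finset.length_sort]
  exact Finset.card_filter_le _ _

theorem nodup_cons_listAbove (W : Finset E) (v : E) : (v :: listAbove W v).Nodup :=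
  List.nodup_cons.2 ⟨fun h => lt_irrefl _ (mem_listAbove.1 h).2, Finset.sort_nodup _ _⟩

theorem nodup_cons_listBelow (W : Finset E) (v : E) : (v :: listBelow W v).Nodup :=
  List.nodup_cons.2 ⟨fun h => lt_irrefl _ (mem_listBelow.1 h).2, Finset.sort_nodup _ _⟩

/-- Scan upwards and downwards from `v`: a reached element has a directed path of probed edges to or
from `v` and is removed. The `1` counts `v` itself. The costs `c'` of the exploration need not be
those of the algorithm, which allows fresh costs on a set `W` fixed earlier. -/
theorem card_rem_le_unreached {c c' : Sym2 E → ℝ} {V W : Finset E} {v : E} (hv : v ∈ V) {i : ℕ}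
    {q : ℝ} (hW : (pivotState c V v i).rem ⊆ W)
    (h : ∀ e ∈ W.sym2, ¬ e.IsDiag → c' e ≤ q → e ∈ (pivotState c V v i).probed) :
    (pivotState c V v i).rem.card ≤ 1 + unreached q c' {v} (listAbove W v) +
      unreached q c' {v} (listBelow W v) := by
  classical
  set s := pivotState c V v i
  have hvW : v ∈ W := hW (pivot_mem_rem c V hv i)
  have hup : ((listAbove W v).filter (fun u => ¬ (u = v ∨ CertLT s.probed v u))).length ≤
      unreached q c' {v} (listAbove W v) := by
    refine length_filter_not_le_unreached (r := (· < ·)) (W := W) ?_ _ _ (by simpa using hvW)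
      (fun u hu => (mem_listAbove.1 hu).1) (by simp) ?_ ?_
    · intro a ha u hu hGa hau hc
      have he := CertLT.of_mem hau (h s(a, u) (Finset.mk_mem_sym2_iff.2 ⟨ha, hu⟩)
        (by simpa using hau.ne) hc)
      rcases hGa with rfl | hGa
      · exact Or.inr he
      · exact Or.inr (hGa.trans he)
    · simp only [Finset.mem_singleton, forall_eq]
      exact fun u hu => (mem_listAbove.1 hu).2
    · exact (Finset.sortedLT_sort _).pairwise
  have hdown : ((listBelow W v).filter (fun u => ¬ (u = v ∨ CertLT s.probed u v))).length ≤
      unreached q c' {v} (listBelow W v) := by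
    refine length_filter_not_le_unreached (r := (· > ·)) (W := W) ?_ _ _ (by simpa using hvW)
      (fun u hu => (mem_listBelow.1 hu).1) (by simp) ?_ ?_
    · intro a ha u hu hGa hau hc
      have he := CertLT.of_mem hau (h s(u, a) (Finset.mk_mem_sym2_iff.2 ⟨hu, ha⟩)
        (by simpa using (ne_of_lt hau)) (by rwa [Sym2.eq_swap]))
      rcases hGa with rfl | hGa
      · exact Or.inr he
      · exact Or.inr (he.trans hGa)
    · simp only [Finset.mem_singleton, forall_eq]
      exact fun u hu => (mem_listBelow.1 hu).2
    · exact (Finset.sortedGT_sort _).pairwise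
  have hsub : s.rem ⊆ ({v} ∪
      ((listAbove W v).filter (fun u => ¬ (u = v ∨ CertLT s.probed v u))).toFinset) ∪
      ((listBelow W v).filter (fun u => ¬ (u = v ∨ CertLT s.probed u v))).toFinset := by
    intro u hu
    have hn := not_certLT_of_mem_rem c V v hu
    simp only [Finset.mem_union, Finset.mem_singleton, List.mem_toFinset, List.mem_filter,
      mem_listAbove, mem_listBelow, decide_eq_true_eq, not_or]
    rcases lt_trichotomy u v with h | h | h
    · exact Or.inr ⟨⟨hW hu, h⟩, h.ne, hn.1⟩
    · exact Or.inl (Or.inl h)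
    · exact Or.inl (Or.inr ⟨⟨hW hu, h⟩, h.ne', hn.2⟩)
  calc s.rem.card ≤ _ := Finset.card_le_card hsub
    _ ≤ _ := Finset.card_union_le _ _
    _ ≤ _ := Nat.add_le_add_right (Finset.card_union_le _ _) _
    _ ≤ _ := Nat.add_le_add (Nat.add_le_add (by simp) ((List.toFinset_card_le _).trans hup))
      ((List.toFinset_card_le _).trans hdown)

end Reachability

/-- The hypotheses exclude two null events at the closed end of the range: a cost equal to `p` would
be seen before resampling, and a fresh value `0` would create a cost equal to `p`. -/
theorem pivotState_resampleCosts {V : Finset E} {v : E} {i : ℕ} {p : ℝ}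
    (hp : threshold V.card i = p) (hp1 : p < 1) {x y : EdgeCosts E} (hx : ∀ e, x e ≠ p)
    (hy : ∀ e, 0 < y e) :
    pivotState (extendCosts (resampleCosts p x y)) V v i = pivotState (extendCosts x) V v i := by
  refine pivotState_congr hp.le fun e he => ?_
  rw [extendCosts_of_not_isDiag _ he, extendCosts_of_not_isDiag _ he, resampleCosts, resampleAbove]
  split_ifs with h
  · exact Or.inl rfl
  · refine Or.inr ⟨?_, lt_of_le_of_ne (not_lt.1 h) (hx _).symm⟩
    have := mul_pos (sub_pos.2 hp1) (hy ⟨e, he⟩)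
    linarith

/-! ### Second moment of the number of remaining elements -/

section RemainingMoment

variable [Fintype E]

/-- With `G = (1 + log n) / q ≥ 1` and `(1 + a + b)² ≤ 3 (1 + a² + b²)`, the two second moments `3
G²` give `3 (3 + 3 + 1) G² = 21 G²`. -/
theorem lintegral_unreached_sq_le {q : ℝ} (h0 : 0 < q) (h1 : q ≤ 1) {n : ℕ} (W : Finset E)
    (v : E) (hn : W.card ≤ n) :
    ∫⁻ y, ((1 + unreached q (extendCosts y) {v} (listAbove W v) +
      unreached q (extendCosts y) {v} (listBelow W v) : ℕ) : ENNReal) ^ 2 ∂(costLaw E) ≤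
      ENNReal.ofReal (21 * ((1 + Real.log n) / q) ^ 2) := by
  have hA := integral_unreached_sq_le (E := E) h0 h1 (nodup_cons_listAbove W v)
    ((length_listAbove_le W v).trans hn)
  have hB := integral_unreached_sq_le (E := E) h0 h1 (nodup_cons_listBelow W v)
    ((length_listBelow_le W v).trans hn)
  have hiA := integrable_unreached (E := E) q {v} (listAbove W v) (fun i => (i : ℝ) ^ 2)
  have hiB := integrable_unreached (E := E) q {v} (listBelow W v) (fun i => (i : ℝ) ^ 2)
  have hiAB : Integrable (fun y : EdgeCosts E =>
      (unreached q (extendCosts y) {v} (listAbove W v) : ℝ) ^ 2 +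
      (unreached q (extendCosts y) {v} (listBelow W v) : ℝ) ^ 2) (costLaw E) := hiA.add hiB
  have hi : Integrable (fun y : EdgeCosts E =>
      3 * (((unreached q (extendCosts y) {v} (listAbove W v) : ℝ) ^ 2 +
      (unreached q (extendCosts y) {v} (listBelow W v) : ℝ) ^ 2) + 1)) (costLaw E) :=
    (hiAB.add (integrable_const 1)).const_mul 3
  have hle : ∀ y : EdgeCosts E, ((1 + unreached q (extendCosts y) {v} (listAbove W v) +
      unreached q (extendCosts y) {v} (listBelow W v) : ℕ) : ENNReal) ^ 2 ≤
      ENNReal.ofReal (3 * (((unreached q (extendCosts y) {v} (listAbove W v) : ℝ) ^ 2 +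
      (unreached q (extendCosts y) {v} (listBelow W v) : ℝ) ^ 2) + 1)) := by
    intro y
    rw [← ENNReal.ofReal_natCast, ← ENNReal.ofReal_pow (Nat.cast_nonneg _)]
    apply ENNReal.ofReal_le_ofReal
    push_cast
    generalize (unreached q (extendCosts y) {v} (listAbove W v) : ℝ) = a
    generalize (unreached q (extendCosts y) {v} (listBelow W v) : ℝ) = b
    nlinarith [sq_nonneg (a - b), sq_nonneg (a - 1), sq_nonneg (b - 1)]
  refine (lintegral_mono hle).trans ?_
  rw [← ofReal_integral_eq_lintegral_ofReal hi
    (Filter.Eventually.of_forall fun y => by positivity)]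
  apply ENNReal.ofReal_le_ofReal
  rw [integral_const_mul, integral_add hiAB (integrable_const 1), integral_add hiA hiB]
  have hG : 1 ≤ (1 + Real.log n) / q := by
    rw [le_div_iff₀ h0]
    linarith [Real.log_natCast_nonneg n]
  simp only [integral_const, probReal_univ, smul_eq_mul, mul_one]
  nlinarith

theorem ae_costLaw_of_ae {P : ℝ → Prop} (h : ∀ᵐ t ∂unitLaw, P t) :
    ∀ᵐ x ∂(costLaw E), ∀ e, P (x e) := by
  rw [ae_all_iff]
  intro e
  exact (Measure.quasiMeasurePreserving_eval (fun _ => unitLaw) e).ae h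

theorem ae_unitLaw_mem : ∀ᵐ t ∂unitLaw, t ∈ Set.Icc (0 : ℝ) 1 :=
  ae_restrict_mem measurableSet_Icc

theorem ae_unitLaw_ne (a : ℝ) : ∀ᵐ t ∂unitLaw, t ≠ a :=
  ae_restrict_of_ae (Measure.ae_ne volume a)

theorem ae_prod_of_ae {P Q : EdgeCosts E → Prop} (hP : ∀ᵐ x ∂(costLaw E), P x)
    (hQ : ∀ᵐ x ∂(costLaw E), Q x) :
    ∀ᵐ z ∂((costLaw E).prod (costLaw E)), P z.1 ∧ Q z.2 :=
  (Measure.quasiMeasurePreserving_fst.ae hP).and (Measure.quasiMeasurePreserving_snd.ae hQ)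

/-- A resampled cost `p + (1 - p) y` is at most the next threshold `2 p` as soon as `y ≤ p`, so the
edge probability available afresh in a round is the previous threshold. For `i = 0` the truncated
subtraction selects the initial threshold itself, where the original costs are already fresh. -/
theorem lintegral_card_rem_sq_le {V : Finset E} (hV : 2 ≤ V.card) {v : E} (hv : v ∈ V) {i : ℕ}
    (hi : i < roundCount V.card) :
    ∫⁻ x, ((pivotState (extendCosts x) V v i).rem.card : ENNReal) ^ 2 ∂(costLaw E) ≤
      ENNReal.ofReal (21 * ((1 + Real.log V.card) / threshold V.card (i - 1)) ^ 2) := by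
  have hpos : ∀ j, 0 < threshold V.card j := fun j => by
    have := one_lt_alpha hV
    unfold threshold; positivity
  cases i with
  | zero =>
    refine (lintegral_mono_ae ?_).trans (lintegral_unreached_sq_le (hpos 0)
      (threshold_lt_one hV hi).le V v le_rfl)
    filter_upwards [ae_costLaw_of_ae ae_unitLaw_mem] with x hx
    have h := card_rem_le_unreached (c := extendCosts x) (c' := extendCosts x) hv
      (i := 0) (q := threshold V.card 0) (pivotState_subset _ V v 0).1 fun e he hd hc =>
        mem_probed_of_le (extendCosts x) V v he hd
          (by rw [extendCosts_of_not_isDiag x hd]; exact (hx _).1) hc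
    gcongr
  | succ i =>
    rw [Nat.add_sub_cancel]
    set p := threshold V.card i with hp
    have hp1 : p < 1 := threshold_lt_one hV (by omega)
    have hp0 : 0 < p := hpos i
    have hm : Measurable fun x : EdgeCosts E =>
        ((pivotState (extendCosts x) V v (i + 1)).rem.card : ENNReal) ^ 2 :=
      measurable_comp_pivotState (fun s => (s.rem.card : ENNReal) ^ 2) V v (i + 1)
    have hmp := measurePreserving_resampleCosts (E := E) hp0.le hp1
    rw [← hmp.lintegral_comp hm]
    have hae := ae_prod_of_ae (ae_costLaw_of_ae (E := E) (ae_unitLaw_mem.and (ae_unitLaw_ne p)))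
      (ae_costLaw_of_ae (E := E) (ae_unitLaw_mem.and (ae_unitLaw_ne 0)))
    have hle : ∀ᵐ z ∂((costLaw E).prod (costLaw E)),
        ((pivotState (extendCosts (resampleCosts p z.1 z.2)) V v (i + 1)).rem.card : ENNReal) ^ 2 ≤
        ((1 + unreached p (extendCosts z.2) {v}
            (listAbove (pivotState (extendCosts z.1) V v i).rem v) +
          unreached p (extendCosts z.2) {v}
            (listBelow (pivotState (extendCosts z.1) V v i).rem v) : ℕ) : ENNReal) ^ 2 := by
      filter_upwards [hae] with z ⟨hx, hy⟩
      have hst := pivotState_resampleCosts (V := V) (v := v) hp.symm hp1 (fun e => (hx e).2)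
        (fun e => lt_of_le_of_ne (hy e).1.1 (hy e).2.symm)
      have h := card_rem_le_unreached (c := extendCosts (resampleCosts p z.1 z.2))
        (c' := extendCosts z.2) hv (i := i + 1) (q := p)
        (W := (pivotState (extendCosts z.1) V v i).rem)
        (by rw [← hst]; exact rem_pivotState_succ_subset _ V v i) (fun e he hd hc => by
          rw [← hst] at he
          rw [extendCosts_of_not_isDiag _ hd] at hc
          refine mem_probed_of_le _ V v (i := i + 1) he hd ?_ ?_ <;>
            rw [extendCosts_of_not_isDiag _ hd, resampleCosts, resampleAbove] <;> split_ifs with h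
          · exact (hx _).1.1
          · have := mul_nonneg (sub_nonneg.2 hp1.le) (hy ⟨e, hd⟩).1.1
            linarith
          · rw [threshold_succ]; linarith
          · have := mul_nonneg hp0.le (hy ⟨e, hd⟩).1.1
            rw [threshold_succ]
            linarith)
      gcongr
    -- For fixed `z.1` the set of remaining elements is deterministic, so the inner integral over
    -- the fresh costs falls under the bound for a fixed set.
    refine (lintegral_mono_ae hle).trans ((lintegral_prod_le _).trans ?_)
    calc _ ≤ ∫⁻ _ : EdgeCosts E, ENNReal.ofReal (21 * ((1 + Real.log V.card) / p) ^ 2)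
          ∂(costLaw E) := lintegral_mono fun x => lintegral_unreached_sq_le hp0 hp1.le _ v
            (Finset.card_le_card (pivotState_subset _ V v i).1)
      _ = _ := by simp

end RemainingMoment

end

/-! ### Expected cost of one call of the pivot routine -/

section

variable {E : Type*} [LinearOrder E]

/-- The cost of a set of comparisons as an extended nonnegative real. -/
noncomputable def ecost (c : Sym2 E → ℝ) (P : Finset (Sym2 E)) : ENNReal :=
  ∑ e ∈ P, ENNReal.ofReal (c e)

theorem ecost_union_le (c : Sym2 E → ℝ) (P Q : Finset (Sym2 E)) :
    ecost c (P ∪ Q) ≤ ecost c P + ecost c Q := by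
  rw [ecost, ecost, ecost, ← Finset.sum_union_inter]
  exact le_self_add

theorem measurable_ecost (P : Finset (Sym2 E)) :
    Measurable fun x : EdgeCosts E => ecost (extendCosts x) P :=
  Finset.measurable_sum _ fun e _ => (measurable_extendCosts_apply e).ennreal_ofReal

theorem ecost_probed_le (c : Sym2 E → ℝ) (V : Finset E) (v : E) (i : ℕ) :
    ecost c (pivotState c V v i).probed ≤
      ecost c (comparisonsIn c V 0 (threshold V.card 0)) + ∑ j ∈ Finset.range i,
        ecost c (comparisonsIn c (pivotState c V v j).rem (threshold V.card j)
          (threshold V.card (j + 1))) := by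
  induction i with
  | zero => simp [pivotState_zero, pivotRound]
  | succ i ih =>
    rw [Finset.sum_range_succ, ← add_assoc]
    exact (ecost_union_le _ _ _).trans (add_le_add_left ih _)

theorem ecost_findRankCertificate_of_card_le_one (c : Sym2 E → ℝ) {V : Finset E}
    (hV : V.card ≤ 1) (v : E) : ecost c (findRankCertificate c V v).probed = 0 := by
  have : (findRankCertificate c V v).probed = ∅ := by
    refine Finset.eq_empty_of_forall_notMem fun e he => ?_
    obtain ⟨h1, h2⟩ := not_isDiag_and_mem_of_mem_probed c V v he
    induction e with
    | _ a b =>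
      rw [Finset.mk_mem_sym2_iff] at h2
      exact h1 (by simpa using Finset.card_le_one.1 hV a h2.1 b h2.2)
  simp [this, ecost]

section Finite

variable [Fintype E]

/-- Every comparison made costs at most `hi`, so it is enough to count them. The events `A e` turn
the count into a sum of indicators that can be integrated termwise. -/
theorem ecost_comparisonsIn_le (x : EdgeCosts E) (W : Finset E) (lo hi : ℝ)
    {A : {e : Sym2 E // ¬ e.IsDiag} → Set (EdgeCosts E)}
    (hA : ∀ e : {e : Sym2 E // ¬ e.IsDiag}, e.1 ∈ W.sym2 → lo ≤ x e → x e ≤ hi → x ∈ A e) :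
    ecost (extendCosts x) (comparisonsIn (extendCosts x) W lo hi) ≤
      ENNReal.ofReal hi * ∑ e, (A e).indicator 1 x := by
  classical
  have h1 : ecost (extendCosts x) (comparisonsIn (extendCosts x) W lo hi) ≤
      ∑ e ∈ comparisonsIn (extendCosts x) W lo hi, ENNReal.ofReal hi :=
    Finset.sum_le_sum fun e he => ENNReal.ofReal_le_ofReal (mem_comparisonsIn.1 he).2.2.2
  refine h1.trans ?_
  simp only [Set.indicator_apply, Pi.one_apply]
  rw [Finset.sum_boole, Finset.sum_const, nsmul_eq_mul, mul_comm]
  gcongr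
  rw [← Finset.card_map (Function.Embedding.subtype _)]
  refine Finset.card_le_card fun e he => ?_
  obtain ⟨h1, h2, h3, h4⟩ := mem_comparisonsIn.1 he
  rw [extendCosts_of_not_isDiag x h2] at h3 h4
  exact Finset.mem_map.2 ⟨⟨e, h2⟩, Finset.mem_filter.2 ⟨Finset.mem_univ _,
    hA ⟨e, h2⟩ h1 h3 h4⟩, rfl⟩

theorem sum_indicator_sym2_le (W : Finset E) :
    ∑ e : {e : Sym2 E // ¬ e.IsDiag}, (if e.1 ∈ W.sym2 then (1 : ENNReal) else 0) ≤
      (W.card : ENNReal) ^ 2 := by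
  rw [Finset.sum_boole]
  have h1 : (Finset.univ.filter fun e : {e : Sym2 E // ¬ e.IsDiag} => e.1 ∈ W.sym2).card ≤
      W.sym2.card := by
    rw [← Finset.card_map (Function.Embedding.subtype _)]
    refine Finset.card_le_card fun e he => ?_
    obtain ⟨e', he', rfl⟩ := Finset.mem_map.1 he
    exact (Finset.mem_filter.1 he').2
  have h2 : W.sym2.card ≤ W.card ^ 2 := by
    rw [Finset.card_sym2, Nat.choose_two_right]
    refine Nat.div_le_of_le_mul ?_
    rw [Nat.add_sub_cancel]
    rcases Nat.eq_zero_or_pos W.card with h | h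
    · simp [h]
    · nlinarith
  exact_mod_cast h1.trans h2

theorem costLaw_le_le (e : {e : Sym2 E // ¬ e.IsDiag}) (t : ℝ) :
    costLaw E {x | x e ≤ t} ≤ ENNReal.ofReal t := by
  have h := (measurePreserving_eval (fun _ : {e : Sym2 E // ¬ e.IsDiag} => unitLaw)
    e).measure_preimage (measurableSet_Iic (a := t)).nullMeasurableSet
  exact h.le.trans (unitLaw_Iic_le t)

theorem lintegral_ecost_initial_le (V : Finset E) (t : ℝ) :
    ∫⁻ x, ecost (extendCosts x) (comparisonsIn (extendCosts x) V 0 t) ∂(costLaw E) ≤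
      ENNReal.ofReal t ^ 2 * (V.card : ENNReal) ^ 2 := by
  classical
  refine (lintegral_mono fun x => ecost_comparisonsIn_le x V 0 t
    (A := fun e => {x | e.1 ∈ V.sym2 ∧ 0 ≤ x e ∧ x e ≤ t})
    fun e h1 h2 h3 => ⟨h1, h2, h3⟩).trans ?_
  have hms : ∀ e : {e : Sym2 E // ¬ e.IsDiag},
      MeasurableSet {x : EdgeCosts E | e.1 ∈ V.sym2 ∧ 0 ≤ x e ∧ x e ≤ t} := fun e =>
    measurableSet_setOfPred.2 (measurable_const.and
      ((measurableSet_setOfPred.1 (measurableSet_le measurable_const (measurable_pi_apply e))).and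
      (measurableSet_setOfPred.1 (measurableSet_le (measurable_pi_apply e) measurable_const))))
  rw [lintegral_const_mul _ (Finset.measurable_sum _ fun e _ => measurable_one.indicator (hms e)),
    lintegral_finsetSum _ fun e _ => measurable_one.indicator (hms e), sq, mul_assoc]
  gcongr
  calc ∑ e, ∫⁻ x, Set.indicator {x : EdgeCosts E | e.1 ∈ V.sym2 ∧ 0 ≤ x e ∧ x e ≤ t} 1 x
        ∂(costLaw E) ≤ ∑ e : {e : Sym2 E // ¬ e.IsDiag}, ENNReal.ofReal t *
          (if e.1 ∈ V.sym2 then 1 else 0) := by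
        refine Finset.sum_le_sum fun e _ => ?_
        rw [lintegral_indicator_one (hms e)]
        split_ifs with h
        · rw [mul_one]
          exact (measure_mono fun x hx => hx.2.2).trans (costLaw_le_le e t)
        · simp [h]
    _ ≤ _ := by
        rw [← Finset.mul_sum]
        gcongr
        exact sum_indicator_sym2_le V

theorem measurableSet_mem_rem (V : Finset E) (v : E) (i : ℕ) (e : Sym2 E) :
    MeasurableSet {x : EdgeCosts E | e ∈ (pivotState (extendCosts x) V v i).rem.sym2} :=
  measurableSet_setOfPred.2 (measurable_comp_pivotState (fun s => e ∈ s.rem.sym2) V v i)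

theorem measurableSet_mem_rem_and (V : Finset E) (v : E) (i : ℕ) (lo hi : ℝ)
    (e : {e : Sym2 E // ¬ e.IsDiag}) :
    MeasurableSet {x : EdgeCosts E | e.1 ∈ (pivotState (extendCosts x) V v i).rem.sym2 ∧
        lo ≤ x e ∧ x e ≤ hi} :=
  (measurableSet_mem_rem V v i e.1).inter
    ((measurableSet_le measurable_const (measurable_pi_apply e)).inter
      (measurableSet_le (measurable_pi_apply e) measurable_const) :
      MeasurableSet ({x : EdgeCosts E | lo ≤ x e} ∩ {x | x e ≤ hi}))

/-- After resampling, survival of the pair depends only on `x`. A cost of at least `p` must be a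
resampled one, and `p + (1 - p) y ≤ 2 p` with `y ≤ 1` forces `y ≤ 2 p`. The two copies are
independent, so the probability factors. -/
theorem costLaw_mem_rem_and_le {V : Finset E} (hV : 2 ≤ V.card) {v : E} {i : ℕ}
    (hi : i < roundCount V.card) (e : {e : Sym2 E // ¬ e.IsDiag}) :
    costLaw E {x | e.1 ∈ (pivotState (extendCosts x) V v i).rem.sym2 ∧
      threshold V.card i ≤ x e ∧ x e ≤ threshold V.card (i + 1)} ≤
    ENNReal.ofReal (threshold V.card (i + 1)) *
      costLaw E {x | e.1 ∈ (pivotState (extendCosts x) V v i).rem.sym2} := by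
  set p := threshold V.card i with hp
  have hp0 : 0 ≤ p := threshold_nonneg _ _
  have hp1 : p < 1 := threshold_lt_one hV hi
  have hm := measurableSet_mem_rem_and V v i p (threshold V.card (i + 1)) e
  have hmp := measurePreserving_resampleCosts (E := E) hp0 hp1
  have hae := ae_prod_of_ae (ae_costLaw_of_ae (E := E) (ae_unitLaw_ne p))
    (ae_costLaw_of_ae (E := E) (ae_unitLaw_mem.and (ae_unitLaw_ne 0)))
  calc _ = ((costLaw E).prod (costLaw E))
        ((fun z : EdgeCosts E × EdgeCosts E => resampleCosts p z.1 z.2) ⁻¹' _) :=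
        (hmp.measure_preimage hm.nullMeasurableSet).symm
    _ ≤ ((costLaw E).prod (costLaw E))
        ({x | e.1 ∈ (pivotState (extendCosts x) V v i).rem.sym2} ×ˢ
          {y | y e ≤ threshold V.card (i + 1)}) := by
        refine measure_mono_ae ?_
        filter_upwards [hae] with z hz hmem
        obtain ⟨hx, hy⟩ := hz
        have hst := pivotState_resampleCosts (V := V) (v := v) hp.symm hp1 hx
          (fun e => lt_of_le_of_ne (hy e).1.1 (hy e).2.symm)
        obtain ⟨h1, h2, h3⟩ := hmem
        refine ⟨?_, ?_⟩
        · simp only [hst] at h1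
          exact h1
        · simp only [resampleCosts, resampleAbove] at h2 h3
          change z.2 e ≤ threshold V.card (i + 1)
          rw [threshold_succ] at h3 ⊢
          split_ifs at h2 h3 with h
          · exact absurd h2 (not_le.2 h)
          · have := mul_nonneg hp0 (sub_nonneg.2 (hy e).1.2)
            linarith
    _ = costLaw E {x | e.1 ∈ (pivotState (extendCosts x) V v i).rem.sym2} *
          costLaw E {y | y e ≤ threshold V.card (i + 1)} := Measure.prod_prod _ _
    _ ≤ _ := by
        rw [mul_comm]
        gcongr
        exact costLaw_le_le e _

theorem sum_costLaw_mem_rem_le (V : Finset E) (v : E) (i : ℕ) :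
    ∑ e : {e : Sym2 E // ¬ e.IsDiag},
      costLaw E {x | e.1 ∈ (pivotState (extendCosts x) V v i).rem.sym2} ≤
    ∫⁻ x, ((pivotState (extendCosts x) V v i).rem.card : ENNReal) ^ 2 ∂(costLaw E) := by
  classical
  have h : ∀ e : {e : Sym2 E // ¬ e.IsDiag},
      costLaw E {x | e.1 ∈ (pivotState (extendCosts x) V v i).rem.sym2} =
      ∫⁻ x, Set.indicator {x | e.1 ∈ (pivotState (extendCosts x) V v i).rem.sym2} 1 x
        ∂(costLaw E) := fun e => (lintegral_indicator_one (measurableSet_mem_rem V v i e.1)).symm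
  rw [Finset.sum_congr rfl fun e _ => h e, ← lintegral_finsetSum _ fun e _ =>
    measurable_one.indicator (measurableSet_mem_rem V v i e.1)]
  refine lintegral_mono fun x => le_trans (le_of_eq ?_) (sum_indicator_sym2_le _)
  exact Finset.sum_congr rfl fun e _ => Set.indicator_apply _ _ _

theorem lintegral_ecost_comparisonsIn_rem_le (V : Finset E) (v : E) (i : ℕ) (lo hi : ℝ) :
    ∫⁻ x, ecost (extendCosts x) (comparisonsIn (extendCosts x)
      (pivotState (extendCosts x) V v i).rem lo hi) ∂(costLaw E) ≤
    ENNReal.ofReal hi * ∑ e : {e : Sym2 E // ¬ e.IsDiag}, costLaw E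
      {x | e.1 ∈ (pivotState (extendCosts x) V v i).rem.sym2 ∧ lo ≤ x e ∧ x e ≤ hi} := by
  classical
  have hle : ∀ x : EdgeCosts E, ecost (extendCosts x) (comparisonsIn (extendCosts x)
      (pivotState (extendCosts x) V v i).rem lo hi) ≤
      ENNReal.ofReal hi * ∑ e : {e : Sym2 E // ¬ e.IsDiag}, Set.indicator
        {x : EdgeCosts E | e.1 ∈ (pivotState (extendCosts x) V v i).rem.sym2 ∧
        lo ≤ x e ∧ x e ≤ hi} 1 x := fun x =>
    ecost_comparisonsIn_le x _ _ _ fun e h1 h2 h3 => ⟨h1, h2, h3⟩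
  refine (lintegral_mono hle).trans (le_of_eq ?_)
  rw [lintegral_const_mul _ (Finset.measurable_sum _ fun e _ =>
      measurable_one.indicator (measurableSet_mem_rem_and V v i lo hi e)),
    lintegral_finsetSum _ fun e _ =>
      measurable_one.indicator (measurableSet_mem_rem_and V v i lo hi e)]
  congr 1
  exact Finset.sum_congr rfl fun e _ =>
    lintegral_indicator_one (measurableSet_mem_rem_and V v i lo hi e)

/-- With `t` the upper threshold and `q` the one from the moment bound, a surviving pair is probed
with probability at most `t`, at cost at most `t`. Then `t ≤ 4 q` gives the constant `16 * 21 =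
336`. -/
theorem lintegral_ecost_round_le {V : Finset E} (hV : 2 ≤ V.card) {v : E} (hv : v ∈ V) {i : ℕ}
    (hi : i < roundCount V.card) :
    ∫⁻ x, ecost (extendCosts x) (comparisonsIn (extendCosts x)
      (pivotState (extendCosts x) V v i).rem (threshold V.card i) (threshold V.card (i + 1)))
      ∂(costLaw E) ≤ ENNReal.ofReal (336 * (1 + Real.log V.card) ^ 2) := by
  refine (lintegral_ecost_comparisonsIn_rem_le V v i _ _).trans ?_
  have hsum := (sum_costLaw_mem_rem_le V v i).trans (lintegral_card_rem_sq_le hV hv hi)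
  have hmem := Finset.sum_le_sum fun e (_ : e ∈ Finset.univ) =>
    costLaw_mem_rem_and_le (v := v) hV hi e
  rw [← Finset.mul_sum] at hmem
  have hq : 0 < threshold V.card (i - 1) := by
    have := one_lt_alpha hV
    unfold threshold; positivity
  have hhi0 : 0 ≤ threshold V.card (i + 1) := threshold_nonneg _ _
  have hhiq : threshold V.card (i + 1) ≤ 4 * threshold V.card (i - 1) := by
    rw [threshold_succ]
    -- For `i = 0` the truncated index makes the ratio of thresholds `2` instead of `4`.
    rcases Nat.eq_zero_or_pos i with rfl | h
    · linarith
    · obtain ⟨j, rfl⟩ := Nat.exists_eq_add_of_lt h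
      rw [Nat.zero_add, Nat.add_sub_cancel, threshold_succ] at *
      linarith
  refine (mul_le_mul_right (hmem.trans (mul_le_mul_right hsum _)) _).trans ?_
  rw [← ENNReal.ofReal_mul hhi0, ← ENNReal.ofReal_mul hhi0]
  apply ENNReal.ofReal_le_ofReal
  generalize threshold V.card (i + 1) = t at *
  generalize threshold V.card (i - 1) = q at *
  generalize 1 + Real.log V.card = g at *
  have h1 : t ^ 2 ≤ 16 * q ^ 2 := by nlinarith
  calc t * (t * (21 * (g / q) ^ 2)) = t ^ 2 * (21 * g ^ 2) / q ^ 2 := by rw [div_pow]; ring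
    _ ≤ _ := by
      rw [div_le_iff₀ (by positivity)]
      nlinarith [mul_le_mul_of_nonneg_right h1 (show 0 ≤ 21 * g ^ 2 by positivity)]

theorem two_thirds_le_log {n : ℕ} (hn : 2 ≤ n) : 2 / 3 ≤ Real.log n := by
  have h1 : Real.log 2 ≤ Real.log n := Real.log_le_log (by norm_num) (by exact_mod_cast hn)
  linarith [Real.log_two_gt_d9]

/-- Dividing by `alpha n > 1` only helps, `1 / log 2 ≤ 3 / 2`, and the `1` lost to the ceiling is at
most `3 / 2 * log n`. -/
theorem roundCount_le {n : ℕ} (hn : 2 ≤ n) : (roundCount n : ℝ) ≤ 3 * Real.log n := by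
  have hL := two_thirds_le_log hn
  have hα := one_lt_alpha hn
  have hn0 : (0 : ℝ) < n := by positivity
  rcases Nat.eq_zero_or_pos (roundCount n) with h | h
  · rw [h, Nat.cast_zero]; linarith
  · have h0 : 0 < Real.logb 2 (n / alpha n) := Nat.ceil_pos.1 h
    have h1 : (roundCount n : ℝ) < Real.logb 2 (n / alpha n) + 1 := Nat.ceil_lt_add_one h0.le
    have h2 : Real.logb 2 (n / alpha n) ≤ Real.logb 2 n :=
      Real.logb_le_logb_of_le (by norm_num) (by positivity)
        (div_le_self hn0.le hα.le)
    have h3 : Real.logb 2 n ≤ 3 / 2 * Real.log n := by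
      rw [Real.logb, div_le_iff₀ (Real.log_pos (by norm_num))]
      nlinarith [two_thirds_le_log (le_refl 2)]
    linarith

/-- The expected cost of a call of the pivot routine is at most `1500000 log⁴ n`. -/
theorem lintegral_ecost_findRankCertificate_le {V : Finset E} (hV : 2 ≤ V.card) {v : E}
    (hv : v ∈ V) :
    ∫⁻ x, ecost (extendCosts x) (findRankCertificate (extendCosts x) V v).probed ∂(costLaw E) ≤
      ENNReal.ofReal (1500000 * Real.log V.card ^ 4) := by
  have hm0 : Measurable fun x : EdgeCosts E =>
      ecost (extendCosts x) (comparisonsIn (extendCosts x) V 0 (threshold V.card 0)) := by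
    have h : Measurable fun z : Finset (Sym2 E) × EdgeCosts E => ecost (extendCosts z.2) z.1 :=
      measurable_from_prod_countable_right fun P => measurable_ecost P
    exact h.comp ((measurable_comparisonsIn V 0 _).prodMk measurable_id)
  have hmj : ∀ j, Measurable fun x : EdgeCosts E => ecost (extendCosts x)
      (comparisonsIn (extendCosts x) (pivotState (extendCosts x) V v j).rem
        (threshold V.card j) (threshold V.card (j + 1))) := by
    intro j
    have h : Measurable fun z : Finset (Sym2 E) × EdgeCosts E => ecost (extendCosts z.2) z.1 :=
      measurable_from_prod_countable_right fun P => measurable_ecost P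
    have h' : Measurable fun z : PivotState E × EdgeCosts E => comparisonsIn (extendCosts z.2)
        z.1.rem (threshold V.card j) (threshold V.card (j + 1)) :=
      measurable_from_prod_countable_right fun s => measurable_comparisonsIn s.rem _ _
    exact h.comp ((h'.comp (f := fun x => (pivotState (extendCosts x) V v j, x))
      ((measurable_pivotState V v j).prodMk measurable_id)).prodMk measurable_id)
  refine (lintegral_mono fun x => ecost_probed_le (extendCosts x) V v
    (roundCount V.card)).trans ?_
  rw [lintegral_add_left hm0, lintegral_finsetSum _ fun j _ => hmj j]
  have hL := two_thirds_le_log hV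
  have hn0 : (0 : ℝ) < V.card := by positivity
  set L := Real.log V.card with hLdef
  calc _ ≤ ENNReal.ofReal (threshold V.card 0) ^ 2 * (V.card : ENNReal) ^ 2 +
        ∑ j ∈ Finset.range (roundCount V.card), ENNReal.ofReal (336 * (1 + L) ^ 2) :=
        add_le_add (lintegral_ecost_initial_le V _) (Finset.sum_le_sum fun j hj =>
          lintegral_ecost_round_le hV hv (Finset.mem_range.1 hj))
    _ = ENNReal.ofReal ((threshold V.card 0 * V.card) ^ 2 +
        roundCount V.card * (336 * (1 + L) ^ 2)) := by
        rw [Finset.sum_const, Finset.card_range, nsmul_eq_mul, ← mul_pow,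
          ← ENNReal.ofReal_natCast, ← ENNReal.ofReal_natCast,
          ← ENNReal.ofReal_mul (threshold_nonneg _ _), ← ENNReal.ofReal_mul (Nat.cast_nonneg _),
          ← ENNReal.ofReal_pow (mul_nonneg (threshold_nonneg _ _) (Nat.cast_nonneg _)),
          ← ENNReal.ofReal_add (by positivity) (by positivity)]
    _ ≤ _ := by
        apply ENNReal.ofReal_le_ofReal
        -- The initial round contributes `α² = 1440000 L⁴`. The others contribute at most `6300 L³ ≤
        -- 9450 L⁴`, because `L ≥ 2 / 3`.
        have h1 : threshold V.card 0 * V.card = 1200 * L ^ 2 := by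
          rw [threshold_zero, div_mul_cancel₀ _ hn0.ne']; rfl
        rw [h1]
        have h2 := roundCount_le hV
        rw [← hLdef] at h2
        have h3 : (roundCount V.card : ℝ) * (336 * (1 + L) ^ 2) ≤ 3 * L * (336 * (1 + L) ^ 2) :=
          mul_le_mul_of_nonneg_right h2 (by positivity)
        have h4 : (1 + L) ^ 2 ≤ (5 / 2 * L) ^ 2 := pow_le_pow_left₀ (by linarith) (by linarith) 2
        have h5 : 3 * L * (336 * (1 + L) ^ 2) ≤ 3 * L * (336 * (5 / 2 * L) ^ 2) := by gcongr
        have h6 : L ^ 3 * (2 / 3) ≤ L ^ 3 * L := mul_le_mul_of_nonneg_left hL (by positivity)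
        nlinarith

end Finite

end

section

/-! ### Real inequalities behind the two recursions -/

section Sums

theorem sum_range_succ_mul_sub (m : ℝ) (n : ℕ) :
    ∑ r ∈ Finset.range n, ((r : ℝ) + 1) * (m - r) =
      n * m + (m - 1) * (n * (n - 1) / 2) - (n - 1) * n * (2 * n - 1) / 6 := by
  induction n with
  | zero => simp
  | succ n ih => rw [Finset.sum_range_succ, ih]; push_cast; ring

/-- The logarithm of the size of the larger part left by a uniformly random pivot is on average
smaller than `log n` by a constant. -/
theorem sum_log_max_le {n : ℕ} (hn : 2 ≤ n) :
    ∑ r ∈ Finset.range n, Real.log (max r (n - 1 - r) : ℕ) ≤ n * Real.log n - n / 6 := by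
  have hn0 : (0 : ℝ) < n := by positivity
  have hterm : ∀ r ∈ Finset.range n, Real.log (max r (n - 1 - r) : ℕ) ≤
      Real.log n - ((r : ℝ) + 1) * (n - r) * (1 / (n * (n + 1))) := by
    intro r hr
    rw [Finset.mem_range] at hr
    have hm0 : (0 : ℝ) < (max r (n - 1 - r) : ℕ) := by
      exact_mod_cast (show 0 < max r (n - 1 - r) by omega)
    have h1 := Real.log_le_sub_one_of_pos (div_pos hm0 hn0)
    rw [Real.log_div hm0.ne' hn0.ne'] at h1
    have hrn : (r : ℝ) + 1 ≤ n := by exact_mod_cast hr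
    have hr0 : (0 : ℝ) ≤ r := Nat.cast_nonneg r
    -- The gap between `n` and the maximum is `min (r + 1) (n - r)`. It is bounded below by the
    -- product of these two numbers over their sum `n + 1`, which is a polynomial in `r` and can be
    -- summed exactly.
    have h2 : ((max r (n - 1 - r) : ℕ) : ℝ) ≤ n - ((r : ℝ) + 1) * (n - r) / (n + 1) := by
      rw [Nat.cast_max, Nat.cast_sub (by omega), Nat.cast_sub (by omega), Nat.cast_one, max_le_iff]
      have e1 : ((r : ℝ) + 1) * (n - r) / (n + 1) ≤ n - r := by
        rw [div_le_iff₀ (by positivity)]; nlinarith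
      have e2 : ((r : ℝ) + 1) * (n - r) / (n + 1) ≤ r + 1 := by
        rw [div_le_iff₀ (by positivity)]; nlinarith
      constructor <;> linarith
    have h3 := div_le_div_of_nonneg_right h2 hn0.le
    have h4 : ((n : ℝ) - ((r : ℝ) + 1) * (n - r) / (n + 1)) / n =
        1 - ((r : ℝ) + 1) * (n - r) * (1 / (n * (n + 1))) := by
      field_simp
    linarith
  refine (Finset.sum_le_sum hterm).trans ?_
  rw [Finset.sum_sub_distrib, Finset.sum_const, Finset.card_range, nsmul_eq_mul,
    ← Finset.sum_mul, sum_range_succ_mul_sub]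
  have : ((n : ℝ) * n + (n - 1) * (n * (n - 1) / 2) - (n - 1) * n * (2 * n - 1) / 6) *
      (1 / (n * (n + 1))) = (n + 2) / 6 := by
    field_simp
    ring
  rw [this]
  linarith

/-- Comparison with the integral of `√x` over `[0, n]`; the induction step rests on `b³ - 3 a² b + 2
a³ = (b - a)² (b + 2 a) ≥ 0`. -/
theorem two_thirds_mul_sqrt_le_sum (n : ℕ) :
    2 / 3 * (n * √(n : ℝ)) ≤ ∑ r ∈ Finset.range n, √((r : ℝ) + 1) := by
  induction n with
  | zero => simp
  | succ n ih =>
    rw [Finset.sum_range_succ]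
    push_cast
    have ha := Real.sqrt_nonneg (n : ℝ)
    have hb := Real.sqrt_nonneg ((n : ℝ) + 1)
    have ha2 := Real.sq_sqrt (Nat.cast_nonneg (α := ℝ) n)
    have hb2 := Real.sq_sqrt (show (0 : ℝ) ≤ n + 1 by positivity)
    have hab : √(n : ℝ) ≤ √((n : ℝ) + 1) := Real.sqrt_le_sqrt (by linarith)
    set a := √(n : ℝ)
    set b := √((n : ℝ) + 1)
    rw [← ha2] at ih ⊢
    rw [← ha2] at hb2
    rw [← hb2]
    have hb1 : 0 < b := by nlinarith
    have key : 2 * (b ^ 2 * b - a ^ 2 * a) ≤ 3 * b := by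
      have : 0 ≤ (b - a) * (b + 2 * a) * (b - a) :=
        mul_nonneg (mul_nonneg (by linarith) (by linarith)) (by linarith)
      have h3 : 3 * b * (b ^ 2 - a ^ 2) = 3 * b := by rw [hb2]; ring
      nlinarith
    nlinarith

theorem log_pow_four_le (n : ℕ) : Real.log n ^ 4 ≤ 4096 * √(n : ℝ) := by
  have h := Real.log_le_rpow_div (Nat.cast_nonneg (α := ℝ) n) (show (0 : ℝ) < 1 / 8 by norm_num)
  calc Real.log n ^ 4 ≤ ((n : ℝ) ^ (1 / 8 : ℝ) / (1 / 8)) ^ 4 :=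
        pow_le_pow_left₀ (Real.log_natCast_nonneg n) h 4
    _ = 4096 * ((n : ℝ) ^ (1 / 8 : ℝ)) ^ 4 := by ring
    _ = 4096 * √(n : ℝ) := by
        rw [← Real.rpow_natCast, ← Real.rpow_mul (Nat.cast_nonneg n), Real.sqrt_eq_rpow]
        norm_num

theorem log_natCast_mono {m n : ℕ} (h : m ≤ n) : Real.log m ≤ Real.log n := by
  rcases Nat.eq_zero_or_pos m with rfl | hm
  · simpa using Real.log_natCast_nonneg n
  · exact Real.log_le_log (by exact_mod_cast hm) (by exact_mod_cast h)

/-- Bound for the expected cost of the pivot routine on `n` elements. -/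
noncomputable def callBound (n : ℕ) : ℝ := 1500000 * Real.log n ^ 4

theorem callBound_nonneg (n : ℕ) : 0 ≤ callBound n := by unfold callBound; positivity

theorem callBound_mono {m n : ℕ} (h : m ≤ n) : callBound m ≤ callBound n := by
  unfold callBound
  have := log_natCast_mono h
  have h0 := Real.log_natCast_nonneg m
  gcongr

/-- Solution of the recursion for the expected cost of sorting `n` elements. -/
noncomputable def sortBound (n : ℕ) : ℝ := 12 * 1500000 * 4096 * ((n : ℝ) + 1 - √((n : ℝ) + 1))

theorem sortBound_nonneg (n : ℕ) : 0 ≤ sortBound n := by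
  have : √((n : ℝ) + 1) ≤ n + 1 :=
    Real.sqrt_le_iff.2 ⟨by positivity, by nlinarith [Nat.cast_nonneg (α := ℝ) n]⟩
  unfold sortBound
  nlinarith

/-- The square root correction gains `4/3 n √n` from the sum on the left and loses at most `5/4 n
√n` on the right. The difference `1/12 n √n` pays for the call, hence the factor `12`. The bound
`√(n + 1) ≤ 5/4 √n` needs `n ≥ 2`; for `n = 1` the call is free. -/
theorem callBound_add_sum_sortBound_le {n : ℕ} (hn : 1 ≤ n) :
    n * callBound n + 2 * ∑ r ∈ Finset.range n, sortBound r ≤ n * sortBound n := by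
  have hn0 : (0 : ℝ) < n := by exact_mod_cast hn
  have hlin : ∑ r ∈ Finset.range n, ((r : ℝ) + 1) = n * (n + 1) / 2 := by
    clear hn0 hn
    induction n with
    | zero => simp
    | succ n ih => rw [Finset.sum_range_succ, ih]; push_cast; ring
  have hsum : ∑ r ∈ Finset.range n, sortBound r = 12 * 1500000 * 4096 *
      (n * (n + 1) / 2 - ∑ r ∈ Finset.range n, √((r : ℝ) + 1)) := by
    unfold sortBound
    rw [← Finset.mul_sum, Finset.sum_sub_distrib, hlin]
  rw [hsum, sortBound, callBound]
  rcases hn.eq_or_lt with rfl | hn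
  · have : √2 ≤ (2 : ℝ) := Real.sqrt_le_iff.2 ⟨by norm_num, by norm_num⟩
    norm_num
  · have h1 := two_thirds_mul_sqrt_le_sum n
    have h2 := mul_le_mul_of_nonneg_left (log_pow_four_le n) hn0.le
    have hn2 : (2 : ℝ) ≤ n := by exact_mod_cast hn
    have h3 : √((n : ℝ) + 1) ≤ 5 / 4 * √(n : ℝ) := by
      rw [Real.sqrt_le_left (by positivity), mul_pow, Real.sq_sqrt hn0.le]
      linarith
    have h4 := mul_le_mul_of_nonneg_left h3 hn0.le
    nlinarith

end Sums

/-! ### Expectations under the pivot distribution -/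

section TSum

theorem tsum_bind_mul {α β : Type*} (p : PMF α) (f : α → PMF β) (g : β → ENNReal) :
    ∑' b, p.bind f b * g b = ∑' a, p a * ∑' b, f a b * g b := by
  simp_rw [PMF.bind_apply, ← ENNReal.tsum_mul_right, ← ENNReal.tsum_mul_left, mul_assoc]
  rw [ENNReal.tsum_comm]

theorem tsum_pure_mul {β : Type*} (b : β) (g : β → ENNReal) :
    ∑' b', PMF.pure b b' * g b' = g b := by
  rw [tsum_eq_single b fun b' hb' => by rw [PMF.pure_apply_of_ne _ _ hb', zero_mul]]
  simp

theorem tsum_map_mul {α β : Type*} (p : PMF α) (f : α → β) (g : β → ENNReal) :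
    ∑' b, p.map f b * g b = ∑' a, p a * g (f a) := by
  rw [PMF.map, tsum_bind_mul]
  simp only [Function.comp_apply, tsum_pure_mul]

theorem tsum_mul_const_add {α : Type*} (p : PMF α) (a : ENNReal) (g : α → ENNReal) :
    ∑' r, p r * (a + g r) = a + ∑' r, p r * g r := by
  simp_rw [mul_add]
  rw [ENNReal.tsum_add, ENNReal.tsum_mul_right, p.tsum_coe, one_mul]

theorem tsum_uniformOfFintype_mul {F : Type*} (V : Finset F) [Nonempty V] (g : V → ENNReal) :
    ∑' v, PMF.uniformOfFintype V v * g v = ∑ v : V, (V.card : ENNReal)⁻¹ * g v := by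
  rw [tsum_fintype]
  simp [PMF.uniformOfFintype_apply]

end TSum

variable {E : Type*} [LinearOrder E]

/-- Sending an element to the number of elements below it is a bijection onto `{0, …, |V| - 1}`: a
uniform pivot has uniform rank. -/
theorem sum_card_filter_lt (V : Finset E) (f : ℕ → ℝ) :
    ∑ v ∈ V, f (V.filter (· < v)).card = ∑ r ∈ Finset.range V.card, f r := by
  have hlt : ∀ a ∈ V, ∀ b ∈ V, a < b → (V.filter (· < a)).card < (V.filter (· < b)).card := by
    intro a ha b _ hab
    refine Finset.card_lt_card (Finset.ssubset_iff_of_subset ?_ |>.2 ⟨a, ?_, ?_⟩)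
    · intro u hu
      rw [Finset.mem_filter] at hu ⊢
      exact ⟨hu.1, hu.2.trans hab⟩
    · exact Finset.mem_filter.2 ⟨ha, hab⟩
    · simp
  have hinj : Set.InjOn (fun v => (V.filter (· < v)).card) (V : Set E) := by
    intro a ha b hb hab
    rcases lt_trichotomy a b with h | h | h
    · exact absurd hab (hlt a ha b hb h).ne
    · exact h
    · exact absurd hab (hlt b hb a ha h).ne'
  have himg : V.image (fun v => (V.filter (· < v)).card) = Finset.range V.card := by
    refine Finset.eq_of_subset_of_card_le ?_ ?_
    · intro r hr
      obtain ⟨v, hv, rfl⟩ := Finset.mem_image.1 hr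
      have := card_filter_lt_add_card_filter_gt hv
      exact Finset.mem_range.2 (by omega)
    · rw [Finset.card_range, Finset.card_image_of_injOn hinj]
  rw [← himg, Finset.sum_image hinj]

/-! ### Cost recursions for fixed costs -/

section ExpectedEcost

/-- The expected cost, over the pivots, as an extended nonnegative real. -/
noncomputable def expectedEcost {α : Type*} (c : Sym2 E → ℝ)
    (p : PMF (α × Finset (Sym2 E))) : ENNReal :=
  ∑' r, p r * ecost c r.2

theorem expectedEcost_map_union_le {α β : Type*} (c : Sym2 E → ℝ)
    (p : PMF (α × Finset (Sym2 E))) (f : α × Finset (Sym2 E) → β) (P : Finset (Sym2 E)) :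
    expectedEcost c (p.map fun r => (f r, P ∪ r.2)) ≤ ecost c P + expectedEcost c p := by
  rw [expectedEcost, tsum_map_mul, expectedEcost, ← tsum_mul_const_add]
  exact ENNReal.tsum_le_tsum fun r => by gcongr; exact ecost_union_le _ _ _

/-- By correctness the recursive calls are written on sets that depend on the pivot but not on the
costs. This is what later allows integration over the costs inside the sum. -/
theorem UnitCosts.expectedEcost_uniformSelection_le {c : Sym2 E → ℝ} (hc : UnitCosts c)
    {V : Finset E} (hV : V.Nonempty) (k : ℕ) :
    expectedEcost c (uniformSelection c V k) ≤ ∑ v : V, (V.card : ENNReal)⁻¹ *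
      (ecost c (findRankCertificate c V v).probed +
        if k ≤ (V.filter (· < v.1)).card then
          expectedEcost c (uniformSelection c (V.filter (· < v.1)) k)
        else if k = (V.filter (· < v.1)).card + 1 then 0
        else expectedEcost c (uniformSelection c (V.filter (v.1 < ·))
          (k - (V.filter (· < v.1)).card - 1))) := by
  have : Nonempty V := hV.to_subtype
  rw [uniformSelection, dif_pos hV, expectedEcost, tsum_bind_mul, tsum_uniformOfFintype_mul]
  refine Finset.sum_le_sum fun v _ => ?_
  gcongr
  simp only [hc.lower_eq v.2, hc.upper_eq v.2]
  split_ifs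
  · exact expectedEcost_map_union_le _ _ _ _
  · rw [tsum_pure_mul, add_zero]
  · exact expectedEcost_map_union_le _ _ _ _

theorem UnitCosts.expectedEcost_uniformSort_le {c : Sym2 E → ℝ} (hc : UnitCosts c)
    {V : Finset E} (hV : V.Nonempty) :
    expectedEcost c (uniformSort c V) ≤ ∑ v : V, (V.card : ENNReal)⁻¹ *
      (ecost c (findRankCertificate c V v).probed +
        (expectedEcost c (uniformSort c (V.filter (· < v.1))) +
          expectedEcost c (uniformSort c (V.filter (v.1 < ·))))) := by
  have : Nonempty V := hV.to_subtype
  rw [uniformSort, dif_pos hV, expectedEcost, tsum_bind_mul, tsum_uniformOfFintype_mul]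
  refine Finset.sum_le_sum fun v _ => ?_
  gcongr
  simp only [hc.lower_eq v.2, hc.upper_eq v.2]
  rw [tsum_bind_mul]
  simp only [tsum_map_mul]
  calc _ ≤ ∑' r₁, uniformSort c (V.filter (· < v.1)) r₁ *
        (ecost c (findRankCertificate c V v).probed + (ecost c r₁.2 +
          expectedEcost c (uniformSort c (V.filter (v.1 < ·))))) := by
        refine ENNReal.tsum_le_tsum fun r₁ => ?_
        gcongr
        rw [← add_assoc, expectedEcost, ← tsum_mul_const_add]
        refine ENNReal.tsum_le_tsum fun r₂ => ?_
        gcongr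
        refine (ecost_union_le _ _ _).trans ?_
        gcongr
        exact ecost_union_le _ _ _
    _ = _ := by
        rw [tsum_mul_const_add]
        congr 1
        simp_rw [add_comm (ecost c _) (expectedEcost c _)]
        rw [tsum_mul_const_add, add_comm]
        rfl

theorem expectedEcost_uniformSelection_empty (c : Sym2 E → ℝ) (k : ℕ) :
    expectedEcost c (uniformSelection c ∅ k) = 0 := by
  rw [uniformSelection, dif_neg (by simp), expectedEcost, tsum_pure_mul]
  simp [ecost]

theorem expectedEcost_uniformSort_empty (c : Sym2 E → ℝ) :
    expectedEcost c (uniformSort c ∅) = 0 := by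
  rw [uniformSort, dif_neg (by simp), expectedEcost, tsum_pure_mul]
  simp [ecost]

end ExpectedEcost

/-! ### Dependence of the algorithms on the costs -/

section Dependence

/-- The costs enter only through the pivot routine. On a finite type its outcomes are finitely many,
so measurability follows without a σ-algebra on distributions. -/
theorem uniformSelection_congr {c c' : Sym2 E → ℝ}
    (h : (findRankCertificate c : Finset E → E → PivotState E) = findRankCertificate c')
    (V : Finset E) (k : ℕ) : uniformSelection c V k = uniformSelection c' V k := by
  induction hn : V.card using Nat.strong_induction_on generalizing V k with
  | _ n ih =>
    subst hn
    rw [uniformSelection, uniformSelection]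
    split_ifs with hV
    · congr 1
      funext v
      rw [ih _ (card_lower_lt c V v) _ _ rfl, ih _ (card_upper_lt c V v) _ _ rfl, h]
    · rfl

theorem uniformSort_congr {c c' : Sym2 E → ℝ}
    (h : (findRankCertificate c : Finset E → E → PivotState E) = findRankCertificate c')
    (V : Finset E) : uniformSort c V = uniformSort c' V := by
  induction hn : V.card using Nat.strong_induction_on generalizing V with
  | _ n ih =>
    subst hn
    rw [uniformSort, uniformSort]
    split_ifs with hV
    · congr 1
      funext v
      rw [ih _ (card_lower_lt c V v) _ rfl, ih _ (card_upper_lt c V v) _ rfl, h]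
    · rfl

theorem uniformSelection_not_isDiag (c : Sym2 E → ℝ) (V : Finset E) (k : ℕ) :
    ∀ r ∈ (uniformSelection c V k).support, ∀ e ∈ r.2, ¬ e.IsDiag := by
  induction hn : V.card using Nat.strong_induction_on generalizing V k with
  | _ n ih =>
    subst hn
    intro r hr e he
    rw [uniformSelection] at hr
    split_ifs at hr with hV
    · obtain ⟨v, -, hr⟩ := (PMF.mem_support_bind_iff _ _ _).1 hr
      have hp : e ∈ (findRankCertificate c V v).probed → ¬ e.IsDiag :=
        fun h => (not_isDiag_and_mem_of_mem_probed c V v h).1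
      split_ifs at hr
      · obtain ⟨r', hr', rfl⟩ := (PMF.mem_support_map_iff _ _ _).1 hr
        exact (Finset.mem_union.1 he).elim hp (ih _ (card_lower_lt c V v) _ _ rfl r' hr' e)
      · rw [PMF.mem_support_pure_iff] at hr
        exact hp (by rwa [hr] at he)
      · obtain ⟨r', hr', rfl⟩ := (PMF.mem_support_map_iff _ _ _).1 hr
        exact (Finset.mem_union.1 he).elim hp (ih _ (card_upper_lt c V v) _ _ rfl r' hr' e)
    · rw [PMF.mem_support_pure_iff] at hr
      simp [hr] at he

theorem uniformSort_not_isDiag (c : Sym2 E → ℝ) (V : Finset E) :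
    ∀ r ∈ (uniformSort c V).support, ∀ e ∈ r.2, ¬ e.IsDiag := by
  induction hn : V.card using Nat.strong_induction_on generalizing V with
  | _ n ih =>
    subst hn
    intro r hr e he
    rw [uniformSort] at hr
    split_ifs at hr with hV
    · obtain ⟨v, -, hr⟩ := (PMF.mem_support_bind_iff _ _ _).1 hr
      obtain ⟨r₁, hr₁, hr⟩ := (PMF.mem_support_bind_iff _ _ _).1 hr
      obtain ⟨r₂, hr₂, rfl⟩ := (PMF.mem_support_map_iff _ _ _).1 hr
      rcases Finset.mem_union.1 he with he | he
      · rcases Finset.mem_union.1 he with he | he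
        · exact (not_isDiag_and_mem_of_mem_probed c V v he).1
        · exact ih _ (card_lower_lt c V v) _ rfl r₁ hr₁ e he
      · exact ih _ (card_upper_lt c V v) _ rfl r₂ hr₂ e he
    · rw [PMF.mem_support_pure_iff] at hr
      simp [hr] at he

theorem findRankCertificate_congr {c c' : Sym2 E → ℝ} (h : ∀ e : Sym2 E, ¬ e.IsDiag → c e = c' e) :
    (findRankCertificate c : Finset E → E → PivotState E) = findRankCertificate c' := by
  funext V v
  exact pivotState_congr le_rfl fun e he => Or.inl (h e he)

/-- Functions of the costs that depend on them measurably except for a dependence through the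
outcomes of the pivot routine are measurable. -/
theorem measurable_of_findRankCertificate [Finite E] {α β : Type*} [MeasurableSpace β]
    {f : EdgeCosts E → α}
    (hf : ∀ x y, (findRankCertificate (extendCosts x) : Finset E → E → PivotState E) =
      findRankCertificate (extendCosts y) → f x = f y)
    {g : α → EdgeCosts E → β} (hg : ∀ a, Measurable (g a)) : Measurable fun x => g (f x) x := by
  classical
  have : Finite (Finset E → E → PivotState E) := inferInstance
  have hσ : Measurable fun x : EdgeCosts E =>
      (findRankCertificate (extendCosts x) : Finset E → E → PivotState E) :=
    measurable_pi_lambda _ fun V => measurable_pi_lambda _ fun v => measurable_pivotState V v _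
  let F : (Finset E → E → PivotState E) → α := fun s =>
    if h : ∃ x : EdgeCosts E, findRankCertificate (extendCosts x) = s then f h.choose else f 0
  have hF : ∀ x, f x = F (findRankCertificate (extendCosts x)) := by
    intro x
    have h : ∃ y : EdgeCosts E, (findRankCertificate (extendCosts y) :
      Finset E → E → PivotState E) = findRankCertificate (extendCosts x) := ⟨x, rfl⟩
    simp only [F, dif_pos h]
    exact hf _ _ h.choose_spec.symm
  have hG : Measurable fun z : (Finset E → E → PivotState E) × EdgeCosts E => g (F z.1) z.2 :=
    measurable_from_prod_countable_right fun s => hg (F s)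
  simp_rw [hF]
  exact hG.comp (f := fun x => (findRankCertificate (extendCosts x), x)) (hσ.prodMk measurable_id)

theorem measurable_expectedEcost {α : Type*} [Countable α] [Finite E]
    (p : PMF (α × Finset (Sym2 E))) :
    Measurable fun x : EdgeCosts E => expectedEcost (extendCosts x) p :=
  Measurable.tsum fun r => (measurable_ecost r.2).const_mul _

theorem measurable_expectedEcost_uniformSelection [Finite E] (V : Finset E) (k : ℕ) :
    Measurable fun x : EdgeCosts E =>
      expectedEcost (extendCosts x) (uniformSelection (extendCosts x) V k) :=
  measurable_of_findRankCertificate (f := fun x => uniformSelection (extendCosts x) V k)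
    (g := fun p x => expectedEcost (extendCosts x) p)
    (fun _ _ h => uniformSelection_congr h V k) measurable_expectedEcost

theorem measurable_expectedEcost_uniformSort [Finite E] (V : Finset E) :
    Measurable fun x : EdgeCosts E =>
      expectedEcost (extendCosts x) (uniformSort (extendCosts x) V) :=
  measurable_of_findRankCertificate (f := fun x => uniformSort (extendCosts x) V)
    (g := fun p x => expectedEcost (extendCosts x) p)
    (fun _ _ h => uniformSort_congr h V) measurable_expectedEcost

theorem measurable_ecost_findRankCertificate [Finite E] (V : Finset E) (v : E) :
    Measurable fun x : EdgeCosts E =>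
      ecost (extendCosts x) (findRankCertificate (extendCosts x) V v).probed :=
  measurable_of_findRankCertificate
    (f := fun x => (findRankCertificate (extendCosts x) V v).probed)
    (g := fun P x => ecost (extendCosts x) P) (fun _ _ h => by rw [h]) measurable_ecost

end Dependence

end

section

theorem sum_inv_card_mul_ofReal {E : Type*} {V : Finset E} (hV : V.Nonempty) (f : V → ℝ)
    (hf : ∀ v, 0 ≤ f v) :
    ∑ v : V, (V.card : ENNReal)⁻¹ * ENNReal.ofReal (f v) =
      ENNReal.ofReal ((∑ v, f v) / V.card) := by
  have hn : (0 : ℝ) < V.card := by exact_mod_cast hV.card_pos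
  rw [← Finset.mul_sum, ← ENNReal.ofReal_sum_of_nonneg fun v _ => hf v,
    ENNReal.ofReal_div_of_pos hn, ENNReal.ofReal_natCast, ENNReal.div_eq_inv_mul]

theorem expectedCost_congr {E : Type*} [Fintype E] {α : Type*} {c c' : Sym2 E → ℝ}
    (h : ∀ e : Sym2 E, ¬ e.IsDiag → c e = c' e) {p : PMF (α × Finset (Sym2 E))}
    (hp : ∀ r ∈ p.support, ∀ e ∈ r.2, ¬ e.IsDiag) : expectedCost c p = expectedCost c' p := by
  refine Finset.sum_congr rfl fun P _ => ?_
  by_cases hP : P ∈ (p.map Prod.snd).support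
  · obtain ⟨r, hr, rfl⟩ := (PMF.mem_support_map_iff _ _ _).1 hP
    congr 1
    exact Finset.sum_congr rfl fun e he => h e (hp r hr e he)
  · rw [(PMF.apply_eq_zero_iff _ _).2 hP]
    simp

theorem expectedCost_nonneg {E : Type*} [Fintype E] {α : Type*} {c : Sym2 E → ℝ} (hc : ∀ e, 0 ≤ c e)
    (p : PMF (α × Finset (Sym2 E))) : 0 ≤ expectedCost c p :=
  Finset.sum_nonneg fun _ _ =>
    mul_nonneg ENNReal.toReal_nonneg (Finset.sum_nonneg fun e _ => hc e)

theorem ofReal_expectedCost {E : Type*} [Fintype E] {α : Type*} {c : Sym2 E → ℝ} (hc : ∀ e, 0 ≤ c e)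
    (p : PMF (α × Finset (Sym2 E))) :
    ENNReal.ofReal (expectedCost c p) = expectedEcost c p := by
  have h := tsum_map_mul p Prod.snd (ecost c)
  rw [expectedEcost, ← h, tsum_fintype, expectedCost, ENNReal.ofReal_sum_of_nonneg
    (f := fun P => ((p.map Prod.snd) P).toReal * certCost c P) fun P _ =>
      mul_nonneg ENNReal.toReal_nonneg (Finset.sum_nonneg fun e _ => hc e)]
  refine Finset.sum_congr rfl fun P _ => ?_
  rw [ENNReal.ofReal_mul ENNReal.toReal_nonneg, ENNReal.ofReal_toReal (PMF.apply_ne_top _ _),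
    certCost, ENNReal.ofReal_sum_of_nonneg fun e _ => hc e, ecost]

variable {E : Type*} [LinearOrder E]

/-! ### Expected cost of selection and sorting -/

section Recursion

variable [Fintype E]

theorem ae_unitCosts_extendCosts : ∀ᵐ x ∂(costLaw E), UnitCosts (extendCosts x) := by
  filter_upwards [ae_costLaw_of_ae ae_unitLaw_mem] with x hx e he
  rw [extendCosts_of_not_isDiag x he]
  exact hx _

theorem lintegral_ecost_findRankCertificate_le_callBound {V : Finset E} {v : E} (hv : v ∈ V) :
    ∫⁻ x, ecost (extendCosts x) (findRankCertificate (extendCosts x) V v).probed ∂(costLaw E) ≤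
      ENNReal.ofReal (callBound V.card) := by
  by_cases hV : 2 ≤ V.card
  · exact lintegral_ecost_findRankCertificate_le hV hv
  · simp_rw [ecost_findRankCertificate_of_card_le_one _ (show V.card ≤ 1 by omega)]
    simp

/-- A recursive bound for the cost that averages over the pivot yields the corresponding bound
for expected values. -/
theorem lintegral_le_of_recursion {V : Finset E} (hV : V.Nonempty) {T : EdgeCosts E → ENNReal}
    {R : V → EdgeCosts E → ENNReal} (hR : ∀ v, Measurable (R v)) {f : V → ℝ} (hf : ∀ v, 0 ≤ f v)
    (hRf : ∀ v, ∫⁻ x, R v x ∂(costLaw E) ≤ ENNReal.ofReal (f v))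
    (hT : ∀ x, UnitCosts (extendCosts x) → T x ≤ ∑ v : V, (V.card : ENNReal)⁻¹ *
      (ecost (extendCosts x) (findRankCertificate (extendCosts x) V v).probed + R v x)) :
    ∫⁻ x, T x ∂(costLaw E) ≤ ENNReal.ofReal ((∑ v, (callBound V.card + f v)) / V.card) := by
  rw [← sum_inv_card_mul_ofReal hV _ fun v => add_nonneg (callBound_nonneg _) (hf v)]
  refine (lintegral_mono_ae (ae_unitCosts_extendCosts.mono hT)).trans ?_
  have hm : ∀ v : V, Measurable fun x : EdgeCosts E =>
      ecost (extendCosts x) (findRankCertificate (extendCosts x) V v).probed + R v x :=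
    fun v => (measurable_ecost_findRankCertificate V v).add (hR v)
  rw [lintegral_finsetSum _ fun v _ => (hm v).const_mul _]
  refine Finset.sum_le_sum fun v _ => ?_
  rw [lintegral_const_mul _ (hm v), lintegral_add_right _ (hR v),
    ENNReal.ofReal_add (callBound_nonneg _) (hf v)]
  gcongr
  · exact lintegral_ecost_findRankCertificate_le_callBound v.2
  · exact hRf v

/-- Keeping `N` fixed bounds every nested call by `callBound N`. The potential `6 * callBound N *
log |V|` drops by at least that much on average, even if the larger part is always kept. -/
theorem lintegral_expectedEcost_uniformSelection_le {N : ℕ} (V : Finset E) (hN : V.card ≤ N)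
    (k : ℕ) :
    ∫⁻ x, expectedEcost (extendCosts x) (uniformSelection (extendCosts x) V k) ∂(costLaw E) ≤
      ENNReal.ofReal (6 * callBound N * Real.log V.card) := by
  induction hn : V.card using Nat.strong_induction_on generalizing V k with
  | _ n ih =>
    subst hn
    have hA : 0 ≤ 6 * callBound N := mul_nonneg (by norm_num) (callBound_nonneg N)
    rcases V.eq_empty_or_nonempty with rfl | hV
    · simp [expectedEcost_uniformSelection_empty]
    have hcard : ∀ v : V, (V.filter (v.1 < ·)).card = V.card - 1 - (V.filter (· < v.1)).card :=
      fun v => by have := card_filter_lt_add_card_filter_gt v.2; omega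
    have hpart : ∀ v : V, (V.filter (· < v.1)).card < V.card :=
      fun v => by have := card_filter_lt_add_card_filter_gt v.2; omega
    have hpos := hV.card_pos
    let g : ℕ → ℝ := fun r => 6 * callBound N * Real.log (max r (V.card - 1 - r) : ℕ)
    refine (lintegral_le_of_recursion hV
      (f := fun v => g (V.filter (· < v.1)).card) ?_ ?_ ?_
      fun x hx => hx.expectedEcost_uniformSelection_le hV k).trans ?_
    · intro v
      split_ifs
      · exact measurable_expectedEcost_uniformSelection _ _
      · exact measurable_const
      · exact measurable_expectedEcost_uniformSelection _ _
    · exact fun v => mul_nonneg hA (Real.log_natCast_nonneg _)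
    · intro v
      split_ifs
      · refine (ih _ (hpart v) _ (by have := hpart v; omega) _ rfl).trans ?_
        exact ENNReal.ofReal_le_ofReal
          (mul_le_mul_of_nonneg_left (log_natCast_mono (le_max_left _ _)) hA)
      · simp
      · refine (ih _ (by rw [hcard]; omega) _ (by rw [hcard]; omega) _ rfl).trans ?_
        refine ENNReal.ofReal_le_ofReal (mul_le_mul_of_nonneg_left (log_natCast_mono ?_) hA)
        rw [hcard]
        exact le_max_right _ _
    · apply ENNReal.ofReal_le_ofReal
      rw [Finset.sum_coe_sort V fun v => callBound V.card + g (V.filter (· < v)).card,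
        sum_card_filter_lt V fun r => callBound V.card + g r, Finset.sum_add_distrib,
        Finset.sum_const, Finset.card_range, nsmul_eq_mul, ← Finset.mul_sum,
        div_le_iff₀ (by exact_mod_cast hpos)]
      -- A singleton makes no comparison: `callBound 1 = 0`, so no drop of the potential is needed.
      rcases (show 1 ≤ V.card from hpos).eq_or_lt with h1 | h1
      · simp [← h1, callBound]
      · have h2 := mul_le_mul_of_nonneg_left (sum_log_max_le h1) hA
        have h3 := mul_le_mul_of_nonneg_left (callBound_mono hN) (Nat.cast_nonneg (α := ℝ) V.card)
        nlinarith

theorem lintegral_expectedEcost_uniformSort_le (V : Finset E) :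
    ∫⁻ x, expectedEcost (extendCosts x) (uniformSort (extendCosts x) V) ∂(costLaw E) ≤
      ENNReal.ofReal (sortBound V.card) := by
  induction hn : V.card using Nat.strong_induction_on generalizing V with
  | _ n ih =>
    subst hn
    rcases V.eq_empty_or_nonempty with rfl | hV
    · simp [expectedEcost_uniformSort_empty]
    have hcard : ∀ v ∈ V, (V.filter (v < ·)).card = V.card - 1 - (V.filter (· < v)).card :=
      fun v hv => by have := card_filter_lt_add_card_filter_gt hv; omega
    have hpart : ∀ v : V, (V.filter (· < v.1)).card < V.card :=
      fun v => by have := card_filter_lt_add_card_filter_gt v.2; omega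
    have hpos := hV.card_pos
    let g : ℕ → ℝ := fun r => sortBound r + sortBound (V.card - 1 - r)
    have hlow := fun W : Finset E => measurable_expectedEcost_uniformSort W
    refine (lintegral_le_of_recursion hV
      (f := fun v => g (V.filter (· < v.1)).card) (fun v => (hlow _).add (hlow _)) ?_ ?_
      fun x hx => hx.expectedEcost_uniformSort_le hV).trans ?_
    · exact fun v => add_nonneg (sortBound_nonneg _) (sortBound_nonneg _)
    · intro v
      simp only [Pi.add_apply]
      rw [lintegral_add_left (hlow _),
        ENNReal.ofReal_add (sortBound_nonneg _) (sortBound_nonneg _)]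
      refine add_le_add (ih _ (hpart v) _ rfl) ?_
      rw [← hcard v v.2]
      exact ih _ (by rw [hcard v v.2]; omega) _ rfl
    · apply ENNReal.ofReal_le_ofReal
      rw [Finset.sum_coe_sort V fun v => callBound V.card + g (V.filter (· < v)).card,
        sum_card_filter_lt V fun r => callBound V.card + g r, Finset.sum_add_distrib,
        Finset.sum_const, Finset.card_range, nsmul_eq_mul, Finset.sum_add_distrib,
        Finset.sum_range_reflect sortBound, div_le_iff₀ (by exact_mod_cast hpos)]
      have := callBound_add_sum_sortBound_le hpos
      linarith

end Recursion

/-! ### From the product law to arbitrary independent uniform costs -/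

section Transfer

theorem measurable_expectedCost [Fintype E] {α : Type*} (p : PMF (α × Finset (Sym2 E))) :
    Measurable fun x : EdgeCosts E => expectedCost (extendCosts x) p :=
  Finset.measurable_sum _ fun _ _ => (Finset.measurable_sum _ fun e _ =>
    measurable_extendCosts_apply e).const_mul _

theorem UnitCosts.extendCosts_nonneg {x : EdgeCosts E} (hx : UnitCosts (extendCosts x))
    (e : Sym2 E) : 0 ≤ extendCosts x e := by
  by_cases he : e.IsDiag
  · simp [extendCosts, he]
  · exact (hx e he).1

/-- Only off-diagonal costs influence the run or its cost, and their joint law is `costLaw E`. There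
costs are almost surely nonnegative, so the finite `lintegral` bound gives both integrability and
the bound on the integral. -/
theorem IIDUniformCosts.integrable_and_integral_le [Fintype E] {Ω : Type*} [MeasurableSpace Ω]
    {μ : Measure Ω} {c : Ω → Sym2 E → ℝ} (hc : IIDUniformCosts μ c) {α : Type*}
    {p : (Sym2 E → ℝ) → PMF (α × Finset (Sym2 E))}
    (hp : ∀ c c' : Sym2 E → ℝ, (findRankCertificate c : Finset E → E → PivotState E) =
      findRankCertificate c' → p c = p c')
    (hd : ∀ c, ∀ r ∈ (p c).support, ∀ e ∈ r.2, ¬ e.IsDiag) {M : ℝ} (hM : 0 ≤ M)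
    (hpM : ∫⁻ x, expectedEcost (extendCosts x) (p (extendCosts x)) ∂(costLaw E) ≤
      ENNReal.ofReal M) :
    Integrable (fun ω => expectedCost (c ω) (p (c ω))) μ ∧
      ∫ ω, expectedCost (c ω) (p (c ω)) ∂μ ≤ M := by
  set Φ : EdgeCosts E → ℝ := fun x => expectedCost (extendCosts x) (p (extendCosts x)) with hΦ
  have hlaw : HasLaw (fun ω (e : {e : Sym2 E // ¬ e.IsDiag}) => c ω e) (costLaw E) μ :=
    hc.indep.hasLaw_pi fun e => hc.law e.1 e.2
  have heq : (fun ω => expectedCost (c ω) (p (c ω))) = Φ ∘ fun ω e => c ω e.1 := by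
    funext ω
    have h : ∀ e : Sym2 E, ¬ e.IsDiag →
        c ω e = extendCosts (fun e : {e : Sym2 E // ¬ e.IsDiag} => c ω e.1) e :=
      fun e he => (extendCosts_of_not_isDiag (fun e => c ω e.1) he).symm
    simp only [hΦ, Function.comp_apply]
    rw [← hp _ _ (findRankCertificate_congr h)]
    exact expectedCost_congr h (hd _)
  have hm : Measurable Φ :=
    measurable_of_findRankCertificate (f := fun x => p (extendCosts x))
      (g := fun p x => expectedCost (extendCosts x) p) (fun _ _ h => hp _ _ h)
      measurable_expectedCost
  have hnonneg : 0 ≤ᵐ[costLaw E] Φ :=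
    ae_unitCosts_extendCosts.mono fun x hx => expectedCost_nonneg hx.extendCosts_nonneg _
  have hlint : ∫⁻ x, ENNReal.ofReal (Φ x) ∂(costLaw E) ≤ ENNReal.ofReal M := by
    refine le_trans (le_of_eq (lintegral_congr_ae ?_)) hpM
    exact ae_unitCosts_extendCosts.mono fun x hx => ofReal_expectedCost hx.extendCosts_nonneg _
  have hint : Integrable Φ (costLaw E) :=
    (lintegral_ofReal_ne_top_iff_integrable hm.aestronglyMeasurable hnonneg).1
      (hlint.trans_lt ENNReal.ofReal_lt_top).ne
  rw [heq]
  refine ⟨(hlaw.map_eq ▸ hint).comp_aemeasurable hlaw.aemeasurable, ?_⟩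
  rw [hlaw.integral_comp hm.aestronglyMeasurable,
    integral_eq_lintegral_of_nonneg_ae hnonneg hm.aestronglyMeasurable]
  exact ENNReal.toReal_le_of_le_ofReal hM hlint

end Transfer

/-- The recursion yields a fifth power; `log n ≥ 2 / 3` for `n ≥ 2` raises it to the sixth, and for
`n ≤ 1` both sides vanish. The constant is chosen to serve sorting as well. -/
theorem six_mul_callBound_mul_log_le (n : ℕ) :
    6 * callBound n * Real.log n ≤ 12 * 1500000 * 4096 * 2 * Real.log n ^ 6 := by
  have h0 := Real.log_natCast_nonneg n
  rcases Nat.lt_or_ge n 2 with h | h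
  · interval_cases n <;> simp
  · have hL := two_thirds_le_log h
    unfold callBound
    have : Real.log n ^ 5 * (2 / 3) ≤ Real.log n ^ 5 * Real.log n :=
      mul_le_mul_of_nonneg_left hL (by positivity)
    have h6 : 0 ≤ Real.log n ^ 6 := by positivity
    nlinarith

/-- Dropping the square root leaves `n + 1 ≤ 2 n`, the source of the last factor `2` in the final
constant. -/
theorem sortBound_le {n : ℕ} (hn : 1 ≤ n) : sortBound n ≤ 12 * 1500000 * 4096 * 2 * n := by
  have h1 : (1 : ℝ) ≤ n := by exact_mod_cast hn
  have := Real.sqrt_nonneg ((n : ℝ) + 1)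
  unfold sortBound
  linarith

end

end UniformCosts

theorem mainTheorem1 :
    -- correctness, for every cost function with values in [0, 1] and every choice of pivots
    (∀ (E : Type*) [Fintype E] [LinearOrder E] (c : Sym2 E → ℝ),
      (∀ e : Sym2 E, ¬ e.IsDiag → c e ∈ Set.Icc (0 : ℝ) 1) →
      (∀ k : ℕ, 1 ≤ k → k ≤ Fintype.card E →
        ∀ r ∈ (UniformCosts.uniformSelection c Finset.univ k).support,
          ∃ x : E, r.1 = some x ∧ (Finset.univ.filter (fun u => u ≤ x)).card = k ∧
            UniformCosts.IsRankCertificate r.2 x) ∧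
      (∀ r ∈ (UniformCosts.uniformSort c (Finset.univ : Finset E)).support,
        (∀ x : E, x ∈ r.1) ∧ UniformCosts.IsSortingCertificate r.2 r.1)) ∧
    -- expected cost
    ∃ C : ℝ, ∀ (E : Type*) [Fintype E] [LinearOrder E]
      (Ω : Type*) [MeasurableSpace Ω] (μ : Measure Ω) [IsProbabilityMeasure μ]
      (c : Ω → Sym2 E → ℝ), UniformCosts.IIDUniformCosts μ c →
      (∀ k : ℕ, 1 ≤ k → k ≤ Fintype.card E →
        Integrable (fun ω => UniformCosts.expectedCost (c ω)
          (UniformCosts.uniformSelection (c ω) Finset.univ k)) μ ∧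
        ∫ ω, UniformCosts.expectedCost (c ω)
          (UniformCosts.uniformSelection (c ω) Finset.univ k) ∂μ
            ≤ C * Real.log (Fintype.card E) ^ 6) ∧
      (Integrable (fun ω => UniformCosts.expectedCost (c ω)
          (UniformCosts.uniformSort (c ω) (Finset.univ : Finset E))) μ ∧
        ∫ ω, UniformCosts.expectedCost (c ω)
          (UniformCosts.uniformSort (c ω) (Finset.univ : Finset E)) ∂μ
            ≤ C * (Fintype.card E : ℝ)) := by
  refine ⟨fun E _ _ c hc => ⟨fun k hk hkE r hr => ?_, fun r hr => ?_⟩,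
    12 * 1500000 * 4096 * 2, fun E _ _ Ω _ μ _ c hc => ⟨fun k hk hkE => ?_, ?_⟩⟩
  · obtain ⟨x, -, hrx, hcard, hcert⟩ :=
      UniformCosts.UnitCosts.uniformSelection_correct hc Finset.univ k hk
        (by rwa [Finset.card_univ]) r hr
    refine ⟨x, hrx, hcard, fun u hu => ?_⟩
    rcases lt_or_gt_of_ne hu with h | h
    · exact Or.inl ((hcert u (Finset.mem_univ u)).1 h)
    · exact Or.inr ((hcert u (Finset.mem_univ u)).2 h)
  · obtain ⟨hs, hm, hcert⟩ := UniformCosts.UnitCosts.uniformSort_correct hc Finset.univ r hr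
    have hm' : ∀ x, x ∈ r.1 := fun x => (hm x).2 (Finset.mem_univ x)
    exact ⟨hm', UniformCosts.isSortingCertificate_of_certLT hs hm' fun a b hab =>
      hcert a (Finset.mem_univ a) b (Finset.mem_univ b) hab⟩
  · have h := UniformCosts.lintegral_expectedEcost_uniformSelection_le
      (Finset.univ : Finset E) le_rfl k
    rw [Finset.card_univ] at h
    refine hc.integrable_and_integral_le
      (fun _ _ h => UniformCosts.uniformSelection_congr h Finset.univ k)
      (fun c => UniformCosts.uniformSelection_not_isDiag c Finset.univ k) (by positivity)
      (h.trans (ENNReal.ofReal_le_ofReal (UniformCosts.six_mul_callBound_mul_log_le _)))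
  · have h : ∫⁻ x, UniformCosts.expectedEcost (UniformCosts.extendCosts x)
        (UniformCosts.uniformSort (UniformCosts.extendCosts x) (Finset.univ : Finset E))
        ∂(UniformCosts.costLaw E) ≤
        ENNReal.ofReal (12 * 1500000 * 4096 * 2 * (Fintype.card E : ℝ)) := by
      rcases (Finset.univ : Finset E).eq_empty_or_nonempty with h0 | h0
      · simp [h0, UniformCosts.expectedEcost_uniformSort_empty]
      · refine (UniformCosts.lintegral_expectedEcost_uniformSort_le _).trans ?_
        rw [Finset.card_univ]
        exact ENNReal.ofReal_le_ofReal (UniformCosts.sortBound_le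
          (by rw [← Finset.card_univ]; exact h0.card_pos))
    exact hc.integrable_and_integral_le
      (fun _ _ h => UniformCosts.uniformSort_congr h Finset.univ)
      (fun c => UniformCosts.uniformSort_not_isDiag c Finset.univ) (by positivity) h
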